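/- Let $\lambda_1,\lambda_2>0$ and $K\ge 4$ be real numbers. For an irrational $\beta\in[0,1]$ put $a_\beta(n)=(\lambda_1-\lambda_2)\bigl(\lfloor (n+1)\beta\rfloor-\lfloor n\beta\rfloor\bigr)+\lambda_2$ for $n\in\mathbb Z$, where $\lfloor x\rfloor$ is the largest integer not exceeding $x$, and let $H=H_\beta$ be the bounded self-adjoint operator on $\ell^2(\mathbb Z)$ (the off-diagonal Sturmian operator) $$H\psi(n)=a_\beta(n)\psi(n+1)+a_\beta(n-1)\psi(n-1),\qquad n\in\mathbb Z .$$ Let $(\delta_n)_{n\in\mathbb Z}$ be the canonical basis of $\ell^2(\mathbb Z)$, let $$P(N,t)=\sum_{|n|>N}\bigl|\langle e^{-itH}\delta_1,\delta_n\rangle\bigr|^2$$ be the outside probabilities, and let $$\Phi(n,z)=T_n(z)\cdots T_1(z),\qquad T_n(z)=\frac1{a_\beta(n)}\begin{pmatrix} z&-1\\ a_\beta(n)^2&0\end{pmatrix}\qquad(n\ge1,\ z\in\mathbb C)$$ be the transfer matrices, with $\|\cdot\|$ the operator norm on Euclidean $\mathbb C^2$. Then there are constants $C,d>0$, depending only on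 $\lambda_1,\lambda_2$ and $K$, such that for every irrational $\beta\in[0,1]$ with $\sigma(H_\beta)\subset[-K+1,K-1]$, every integer $N\ge1$ and every real $t>0$, $$P(N,t)\le C\left(e^{-dN}+t^4\int_{-K}^{K}\Bigl(\max_{1\le n\le N}\bigl\|\Phi(n,E+\tfrac it)\bigr\|^2\Bigr)^{-1}dE\right).$$ -/

import Mathlib

open scoped Matrix.Norms.L2Operator

noncomputable section

/-- The Hilbert space `ℓ²(ℤ)` of square-summable complex sequences indexed by `ℤ`. -/
abbrev EllTwo : Type := lp (fun _ : ℤ => ℂ) 2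

/-- The canonical basis vector `δ_n` of `ℓ²(ℤ)`. -/
def delta (n : ℤ) : EllTwo := lp.single 2 n (1 : ℂ)

lemma weightedShift_memlp_and_norm {c : ℤ → ℝ} {C : ℝ} (hc : ∀ n, |c n| ≤ C) (k : ℤ)
    (ψ : EllTwo) :
    ∃ h : Memℓp (fun n : ℤ => (c n : ℂ) * ψ (n + k)) 2,
      ‖(⟨fun n : ℤ => (c n : ℂ) * ψ (n + k), h⟩ : EllTwo)‖ ≤ C * ‖ψ‖ := by
  have hC : 0 ≤ C := (abs_nonneg _).trans (hc 0)
  have h2 : (0 : ℝ) < (2 : ENNReal).toReal := by norm_num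
  have hs : Summable fun n : ℤ => ‖ψ n‖ ^ (2 : ENNReal).toReal :=
    (lp.memℓp ψ).summable h2
  have hs' : Summable fun n : ℤ => ‖ψ (n + k)‖ ^ (2 : ENNReal).toReal :=
    (Equiv.addRight k).summable_iff.mpr hs
  have hle : ∀ n : ℤ, ‖(c n : ℂ) * ψ (n + k)‖ ^ (2 : ENNReal).toReal
      ≤ C ^ (2 : ENNReal).toReal * ‖ψ (n + k)‖ ^ (2 : ENNReal).toReal := by
    intro n
    rw [← Real.mul_rpow hC (norm_nonneg _), norm_mul, Complex.norm_real, Real.norm_eq_abs]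
    exact Real.rpow_le_rpow (by positivity)
      (mul_le_mul_of_nonneg_right (hc n) (norm_nonneg _)) h2.le
  have hsum : Summable fun n : ℤ => ‖(c n : ℂ) * ψ (n + k)‖ ^ (2 : ENNReal).toReal :=
    Summable.of_nonneg_of_le (fun n => by positivity) hle (hs'.mul_left _)
  refine ⟨memℓp_gen hsum, lp.norm_le_of_tsum_le h2 (by positivity) ?_⟩
  calc ∑' n : ℤ, ‖(c n : ℂ) * ψ (n + k)‖ ^ (2 : ENNReal).toReal
      ≤ ∑' n : ℤ, C ^ (2 : ENNReal).toReal * ‖ψ (n + k)‖ ^ (2 : ENNReal).toReal :=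
        hsum.tsum_le_tsum hle (hs'.mul_left _)
    _ = C ^ (2 : ENNReal).toReal * ∑' n : ℤ, ‖ψ (n + k)‖ ^ (2 : ENNReal).toReal := tsum_mul_left
    _ = C ^ (2 : ENNReal).toReal * ∑' n : ℤ, ‖ψ n‖ ^ (2 : ENNReal).toReal := by
        rw [(Equiv.addRight k).tsum_eq (fun n : ℤ => ‖ψ n‖ ^ (2 : ENNReal).toReal) |>.symm]
        rfl
    _ = (C * ‖ψ‖) ^ (2 : ENNReal).toReal := by
        rw [Real.mul_rpow hC (norm_nonneg _), lp.norm_rpow_eq_tsum h2]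

/-- For a bounded real sequence `c`, the bounded operator `ψ ↦ (n ↦ c n * ψ (n + k))`
on `ℓ²(ℤ)`. -/
def weightedShift (c : ℤ → ℝ) (hc : ∃ C : ℝ, ∀ n, |c n| ≤ C) (k : ℤ) : EllTwo →L[ℂ] EllTwo :=
  LinearMap.mkContinuousOfExistsBound
    { toFun := fun ψ => ⟨fun n : ℤ => (c n : ℂ) * ψ (n + k),
        (weightedShift_memlp_and_norm hc.choose_spec k ψ).1⟩
      map_add' := fun ψ φ => by
        ext n
        exact mul_add (c n : ℂ) (ψ (n + k)) (φ (n + k))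
      map_smul' := fun s ψ => by
        ext n
        simp [mul_left_comm] }
    ⟨hc.choose, fun ψ => (weightedShift_memlp_and_norm hc.choose_spec k ψ).2⟩

/-- The Jacobi operator
`H ψ(n) = a(n) ψ(n+1) + a(n-1) ψ(n-1) + b(n) ψ(n)` on `ℓ²(ℤ)`, for bounded real sequences
`a`, `b` (see `jacobiOperator_apply`). -/
def jacobiOperator (a b : ℤ → ℝ) (ha : ∃ C : ℝ, ∀ n, |a n| ≤ C)
    (hb : ∃ C : ℝ, ∀ n, |b n| ≤ C) : EllTwo →L[ℂ] EllTwo :=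
  weightedShift a ha 1
    + weightedShift (fun n => a (n - 1)) (ha.imp fun _ h n => h (n - 1)) (-1)
    + weightedShift b hb 0

theorem jacobiOperator_apply (a b : ℤ → ℝ) (ha : ∃ C : ℝ, ∀ n, |a n| ≤ C)
    (hb : ∃ C : ℝ, ∀ n, |b n| ≤ C) (ψ : EllTwo) (n : ℤ) :
    jacobiOperator a b ha hb ψ n
      = (a n : ℂ) * ψ (n + 1) + (a (n - 1) : ℂ) * ψ (n - 1) + (b n : ℂ) * ψ n := by
  have h : jacobiOperator a b ha hb ψ n
      = (a n : ℂ) * ψ (n + 1) + (a (n - 1) : ℂ) * ψ (n + -1) + (b n : ℂ) * ψ (n + 0) := rfl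
  rw [h, add_zero, ← sub_eq_add_neg]

/-- The off-diagonal Sturmian sequence
`a(n) = (l₁ - l₂) (⌊(n+1) β⌋ - ⌊n β⌋) + l₂`. -/
def sturmianHopping (l₁ l₂ β : ℝ) (n : ℤ) : ℝ :=
  (l₁ - l₂) * ((⌊((n : ℝ) + 1) * β⌋ - ⌊(n : ℝ) * β⌋ : ℤ) : ℝ) + l₂

lemma sturmianHopping_bounded (l₁ l₂ β : ℝ) :
    ∃ C : ℝ, ∀ n, |sturmianHopping l₁ l₂ β n| ≤ C := by
  refine ⟨|l₁ - l₂| * (|β| + 1) + |l₂|, fun n => ?_⟩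
  have h : |((⌊((n : ℝ) + 1) * β⌋ - ⌊(n : ℝ) * β⌋ : ℤ) : ℝ)| ≤ |β| + 1 := by
    push_cast
    have h1 := Int.floor_le (((n : ℝ) + 1) * β)
    have h2 := Int.lt_floor_add_one (((n : ℝ) + 1) * β)
    have h3 := Int.floor_le ((n : ℝ) * β)
    have h4 := Int.lt_floor_add_one ((n : ℝ) * β)
    have h5 := le_abs_self β
    have h6 := neg_abs_le β
    rw [abs_le]
    constructor <;> linarith
  unfold sturmianHopping
  refine (abs_add_le _ _).trans ?_
  rw [abs_mul]
  gcongr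

/-- The off-diagonal Sturmian operator: the Jacobi operator with the hopping sequence
`sturmianHopping l₁ l₂ β` and `b = 0`. -/
def sturmianOperator (l₁ l₂ β : ℝ) : EllTwo →L[ℂ] EllTwo :=
  jacobiOperator (sturmianHopping l₁ l₂ β) (fun _ => 0) (sturmianHopping_bounded l₁ l₂ β)
    ⟨0, fun _ => by simp⟩

/-- The unitary group `e^{-itH}` of a bounded self-adjoint operator `H`, given by the
exponential series. -/
def evolution (H : EllTwo →L[ℂ] EllTwo) (t : ℝ) : EllTwo →L[ℂ] EllTwo :=
  NormedSpace.exp ((-(Complex.I * (t : ℂ))) • H)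

/-- `a(n,t) = |⟨e^{-itH} δ_1, δ_n⟩|²`, the probability of being at site `n` at time `t`. -/
def siteProb (H : EllTwo →L[ℂ] EllTwo) (n : ℤ) (t : ℝ) : ℝ :=
  ‖inner ℂ (delta n) (evolution H t (delta 1))‖ ^ 2

/-- The outside probability `P(N,t) = ∑_{|n| > N} a(n,t)`. -/
def outsideProb (H : EllTwo →L[ℂ] EllTwo) (N : ℕ) (t : ℝ) : ℝ :=
  ∑' n : {n : ℤ // (N : ℤ) < |n|}, siteProb H n t

/-- The one-step matrix `T_n(z) = a(n)⁻¹ [[z, -1], [a(n)², 0]]`, which maps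
`(ψ(n), a(n-1) ψ(n-1))` to `(ψ(n+1), a(n) ψ(n))` for solutions of `Hψ = zψ` with `b = 0`. -/
def stepMatrix (a : ℤ → ℝ) (n : ℤ) (z : ℂ) : Matrix (Fin 2) (Fin 2) ℂ :=
  ((a n : ℂ)⁻¹) • !![z, -1; (a n : ℂ) ^ 2, 0]

/-- The transfer matrix `Φ(n,z) = T_n(z) ⋯ T_1(z)`. -/
def transferMatrix (a : ℤ → ℝ) : ℕ → ℂ → Matrix (Fin 2) (Fin 2) ℂ
  | 0, _ => 1
  | n + 1, z => stepMatrix a ((n : ℤ) + 1) z * transferMatrix a n z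

/-- `max_{1 ≤ n ≤ N} ‖Φ(n,z)‖²`, with the operator norm of `2 × 2` matrices acting on
Euclidean `ℂ²`. -/
def maxTransferNormSq (a : ℤ → ℝ) (N : ℕ) (hN : 1 ≤ N) (z : ℂ) : ℝ :=
  (Finset.Icc 1 N).sup' (Finset.nonempty_Icc.mpr hN) fun n => ‖transferMatrix a n z‖ ^ 2

end

/-! The evolution is a Cauchy integral of $e^{-itz}(z-H)^{-1}$ around the rectangle with vertical
sides $\pm K$, bottom at height $-1$ and top at height $d=\min(1,1/t)$, so that
$|e^{-itz}|=e^{t\,\mathrm{Im} z}\le e$ on the whole contour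
(`inner_exp_smul_apply_eq_rectIntegral`). The sides and the bottom stay at distance at least 1 from
the spectrum, where the Combes–Thomas estimate `norm_resolvent_delta_le` makes the kernel decay
exponentially; they produce $e^{-dN}$. For $t\le1$ the top is that far away too.

For $t\ge1$ the top side, after Cauchy–Schwarz in $E$, requires a bound on
$\sum_{|n|>N}|\langle\delta_n,(z-H)^{-1}\delta_1\rangle|^2$ at $\mathrm{Im} z=1/t$. Cut the bond
$(k,k+1)$ for some $k\le N$. The cut resolvent vector $v$ vanishes to the right of $k$, and there
the full kernel equals $a(k)v(k)$ times the kernel with source $k+1$ (`resolvent_eq_cutBond_add`).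
The matrix $\Phi(k,z)$ carries the data of $v$ near the origin to $(0,a(k)v(k))$; since
$\det\Phi=1$, a large first row of $\Phi$ forces $a(k)v(k)$ to be small (`first_row_bound`). Each of
the two resolvents costs $(\mathrm{Im} z)^{-2}$, hence $t^4$.

The left half-line reduces to the right one by reflection, because irrationality of $\beta$ gives
$a(-n-1)=a(n)$ for $n\ge1$. -/

noncomputable section

/-! ### Cauchy's formula on a rectangle -/

/-- The integral of `f` along the boundary of the rectangle `[a, b] × [c, d]`. -/
def rectIntegral (f : ℂ → ℂ) (a b c d : ℝ) : ℂ :=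
  (∫ x : ℝ in a..b, f (x + c * Complex.I)) - (∫ x : ℝ in a..b, f (x + d * Complex.I))
    + Complex.I • (∫ y : ℝ in c..d, f (b + y * Complex.I))
    - Complex.I • ∫ y : ℝ in c..d, f (a + y * Complex.I)

lemma rectIntegral_eq (f : ℂ → ℂ) (a b c d : ℝ) :
    rectIntegral f a b c d
      = (∫ x : ℝ in a..b, f (c * Complex.I + x * 1))
        - (∫ x : ℝ in a..b, f (d * Complex.I + x * 1))
        + Complex.I • (∫ y : ℝ in c..d, f (b + y * Complex.I))
        - Complex.I • ∫ y : ℝ in c..d, f (a + y * Complex.I) := by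
  simp only [rectIntegral, mul_one, add_comm]

lemma integral_inv_of_mem_slitPlane {p v : ℂ} {a b : ℝ}
    (h : ∀ s ∈ Set.uIcc a b, p + s * v ∈ Complex.slitPlane) :
    v • ∫ s : ℝ in a..b, (p + s * v)⁻¹ = Complex.log (p + b * v) - Complex.log (p + a * v) := by
  rw [smul_eq_mul, ← intervalIntegral.integral_const_mul]
  refine intervalIntegral.integral_eq_sub_of_hasDerivAt
    (f := fun s : ℝ => Complex.log (p + s * v)) (fun s hs => ?_) ?_
  · have h1 : HasDerivAt (fun s : ℝ => p + (s : ℂ) * v) v s := by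
      simpa using ((Complex.ofRealCLM.hasDerivAt (x := s)).mul_const v).const_add p
    have := h1.clog_real (h s hs)
    simpa [div_eq_mul_inv] using this
  · refine ContinuousOn.intervalIntegrable ?_
    refine continuousOn_const.mul (ContinuousOn.inv₀ (by fun_prop) fun s hs => ?_)
    exact Complex.slitPlane_ne_zero (h s hs)

lemma log_sub_log_neg_of_im_pos {w : ℂ} (hw : 0 < w.im) :
    Complex.log w - Complex.log (-w) = Real.pi * Complex.I := by
  rw [Complex.log, Complex.log, Complex.arg_neg_eq_arg_sub_pi_of_im_pos hw, norm_neg]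
  push_cast
  ring

/-- The principal logarithm is a primitive on the bottom, top and right sides. The left side crosses
its cut, so $\log(-w)$ serves there; the two left corners each contribute a mismatch of $\pi i$. -/
lemma rectIntegral_inv_sub {a b c d x : ℝ} (ha : a < x) (hb : x < b) (hc : c < 0) (hd : 0 < d) :
    rectIntegral (fun z => (z - x)⁻¹) a b c d = 2 * Real.pi * Complex.I := by
  have h1 : (∫ s : ℝ in a..b, ((s : ℂ) + c * Complex.I - x)⁻¹)
      = Complex.log (b + c * Complex.I - x) - Complex.log (a + c * Complex.I - x) := by
    have := integral_inv_of_mem_slitPlane (p := c * Complex.I - x) (v := 1) (a := a) (b := b)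
      fun s _ => Or.inr (by simpa using hc.ne)
    simp only [one_smul, mul_one] at this
    convert this using 3 <;> ring_nf
  have h2 : (∫ s : ℝ in a..b, ((s : ℂ) + d * Complex.I - x)⁻¹)
      = Complex.log (b + d * Complex.I - x) - Complex.log (a + d * Complex.I - x) := by
    have := integral_inv_of_mem_slitPlane (p := d * Complex.I - x) (v := 1) (a := a) (b := b)
      fun s _ => Or.inr (by simpa using hd.ne')
    simp only [one_smul, mul_one] at this
    convert this using 3 <;> ring_nf
  have h3 : Complex.I • (∫ s : ℝ in c..d, ((b : ℂ) + s * Complex.I - x)⁻¹)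
      = Complex.log (b + d * Complex.I - x) - Complex.log (b + c * Complex.I - x) := by
    have := integral_inv_of_mem_slitPlane (p := b - x) (v := Complex.I) (a := c) (b := d)
      fun s _ => Or.inl (by simpa using hb)
    convert this using 3
    · ext s
      ring_nf
    · ring_nf
    · ring_nf
  have h4 : Complex.I • (∫ s : ℝ in c..d, ((a : ℂ) + s * Complex.I - x)⁻¹)
      = Complex.log (-(a + d * Complex.I - x)) - Complex.log (-(a + c * Complex.I - x)) := by
    have := integral_inv_of_mem_slitPlane (p := x - a) (v := -Complex.I) (a := c) (b := d)
      fun s _ => Or.inl (by simpa using ha)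
    rw [neg_smul, ← smul_neg, ← intervalIntegral.integral_neg] at this
    convert this using 3
    · ext s
      rw [← inv_neg]
      ring_nf
    · ring_nf
    · ring_nf
  have h5 := log_sub_log_neg_of_im_pos (w := a + d * Complex.I - x) (by simpa using hd)
  have h6 := log_sub_log_neg_of_im_pos (w := -(a + c * Complex.I - x)) (by simpa using hc)
  rw [neg_neg] at h6
  rw [rectIntegral, h1, h2, h3, h4]
  linear_combination h5 + h6

/-- Cauchy's integral formula for a rectangle, at a point of the real axis. -/
lemma rectIntegral_cauchy {a b c d x : ℝ} (ha : a < x) (hb : x < b) (hc : c < 0) (hd : 0 < d)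
    {F : ℂ → ℂ} (hF : Differentiable ℂ F) :
    rectIntegral (fun z => F z * (z - x)⁻¹) a b c d = 2 * Real.pi * Complex.I * F x := by
  -- The difference quotient of an entire function is entire, so its boundary integral vanishes and
  -- only $F(x)/(z-x)$ remains.
  have hdiff : Differentiable ℂ (dslope F x) := by
    rw [← differentiableOn_univ] at hF ⊢
    exact (Complex.differentiableOn_dslope Filter.univ_mem).2 hF
  have h0 : rectIntegral (dslope F x) a b c d = 0 :=
    Complex.integral_boundary_rect_eq_zero_of_differentiableOn (dslope F x)
      (⟨a, c⟩ : ℂ) (⟨b, d⟩ : ℂ) hdiff.differentiableOn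
  have key : ∀ (p v : ℂ) (s t : ℝ), (∀ r ∈ Set.uIcc s t, p + r * v - x ≠ 0) →
      (∫ r : ℝ in s..t, F (p + r * v) * (p + r * v - x)⁻¹)
        = (∫ r : ℝ in s..t, dslope F x (p + r * v))
          + F x * ∫ r : ℝ in s..t, (p + r * v - x)⁻¹ := by
    intro p v s t h
    rw [← intervalIntegral.integral_const_mul, ← intervalIntegral.integral_add]
    · refine intervalIntegral.integral_congr fun r hr => ?_
      have := h r hr
      rw [dslope_of_ne _ (sub_ne_zero.1 this), slope_def_field]
      field_simp
      ring
    · exact (hdiff.continuous.comp (by fun_prop)).intervalIntegrable _ _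
    · exact (continuousOn_const.mul (ContinuousOn.inv₀ (by fun_prop) h)).intervalIntegrable
  have k1 : ∀ e : ℝ, e ≠ 0 → (∫ r : ℝ in a..b, F (r + e * Complex.I) * (r + e * Complex.I - x)⁻¹)
        = (∫ r : ℝ in a..b, dslope F x (r + e * Complex.I))
          + F x * ∫ r : ℝ in a..b, (r + e * Complex.I - x)⁻¹ := by
    intro e he
    have := key (e * Complex.I) 1 a b fun r _ h => he (by simpa using congrArg Complex.im h)
    simpa only [mul_one, add_comm] using this
  have k2 : ∀ e : ℝ, e ≠ x → (∫ r : ℝ in c..d, F (e + r * Complex.I) * (e + r * Complex.I - x)⁻¹)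
        = (∫ r : ℝ in c..d, dslope F x (e + r * Complex.I))
          + F x * ∫ r : ℝ in c..d, (e + r * Complex.I - x)⁻¹ := fun e he =>
    key e Complex.I c d fun r _ h => he (by simpa [sub_eq_zero] using congrArg Complex.re h)
  have h1 := rectIntegral_inv_sub ha hb hc hd
  simp only [rectIntegral, smul_eq_mul] at h0 h1 ⊢
  rw [k1 c hc.ne, k1 d hd.ne', k2 b hb.ne', k2 a ha.ne]
  linear_combination h0 + F x * h1

/-! ### Resolvents and functional calculus -/

section Resolvent

variable {E : Type*} [NormedAddCommGroup E] [InnerProductSpace ℂ E] [CompleteSpace E]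

lemma mul_resolvent_of_notMem {A : Type*} [Ring A] [Algebra ℂ A] {a : A} {z : ℂ}
    (hz : z ∉ spectrum ℂ a) :
    (algebraMap ℂ A z - a) * resolvent a z = 1 :=
  Ring.mul_inverse_cancel _ (spectrum.notMem_iff.1 hz)

lemma resolvent_mul_of_notMem {A : Type*} [Ring A] [Algebra ℂ A] {a : A} {z : ℂ}
    (hz : z ∉ spectrum ℂ a) :
    resolvent a z * (algebraMap ℂ A z - a) = 1 :=
  Ring.inverse_mul_cancel _ (spectrum.notMem_iff.1 hz)

lemma spectrum_restrict_id (s : Set ℂ) [CompactSpace s] :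
    spectrum ℂ ((ContinuousMap.id ℂ).restrict s) = s := by
  rw [ContinuousMap.spectrum_eq_range]
  ext x
  simp

lemma resolvent_restrict_id_apply {s : Set ℂ} [CompactSpace s] {z : ℂ} (hz : z ∉ s) (x : s) :
    resolvent ((ContinuousMap.id ℂ).restrict s) z x = (z - x)⁻¹ := by
  have h : z ∉ spectrum ℂ ((ContinuousMap.id ℂ).restrict s) := by rwa [spectrum_restrict_id]
  have := congrArg (fun f : C(s, ℂ) => f x) (mul_resolvent_of_notMem h)
  exact eq_inv_of_mul_eq_one_right (by simpa using this)

/-- A unital homomorphism preserves inverses. This lets operator identities between resolvents be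
checked pointwise on the spectrum. -/
lemma cfcHom_resolvent {H : E →L[ℂ] E} (hH : IsStarNormal H) {z : ℂ} (hz : z ∉ spectrum ℂ H) :
    cfcHom hH (resolvent ((ContinuousMap.id ℂ).restrict (spectrum ℂ H)) z) = resolvent H z := by
  have h : z ∉ spectrum ℂ ((ContinuousMap.id ℂ).restrict (spectrum ℂ H)) := by
    rwa [spectrum_restrict_id]
  have h1 := congrArg (cfcHom hH) (mul_resolvent_of_notMem h)
  rw [map_mul, map_sub, cfcHom_id, map_one, AlgHomClass.commutes] at h1
  rw [← one_mul (cfcHom hH _), ← resolvent_mul_of_notMem hz, mul_assoc, h1, mul_one]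

/-- The functional calculus of a normal operator is isometric, so the norm is the supremum of
$1/|z-x|$ over the spectrum. -/
lemma norm_resolvent_le {H : E →L[ℂ] E} (hH : IsStarNormal H) {z : ℂ} {r : ℝ} (hr : 0 < r)
    (h : ∀ x ∈ spectrum ℂ H, r ≤ ‖z - x‖) : ‖resolvent H z‖ ≤ r⁻¹ := by
  have hz : z ∉ spectrum ℂ H := fun hz => by simpa using hr.trans_le (h z hz)
  rw [← cfcHom_resolvent hH hz, norm_cfcHom H _ hH, ContinuousMap.norm_le _ (by positivity)]
  intro x
  rw [resolvent_restrict_id_apply hz, norm_inv]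
  exact inv_anti₀ hr (h x x.2)

lemma continuousOn_resolvent {A : Type*} [NormedRing A] [NormedAlgebra ℂ A] [CompleteSpace A]
    (a : A) {s : Set ℂ} (hs : Disjoint s (spectrum ℂ a)) : ContinuousOn (resolvent a) s :=
  fun _ hz => (spectrum.hasDerivAt_resolvent_const_left (𝕜 := ℂ)
    (not_not.1 (Set.disjoint_left.1 hs hz))).continuousAt.continuousWithinAt

/-- The unitary group as a contour integral of the resolvent. -/
lemma inner_exp_smul_apply_eq_rectIntegral {H : E →L[ℂ] E} (hH : IsStarNormal H) {a b c d : ℝ}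
    (hσ : spectrum ℂ H ⊆ (fun x : ℝ => (x : ℂ)) '' Set.Ioo a b) (hc : c < 0) (hd : 0 < d)
    (w : ℂ) (u v : E) :
    rectIntegral (fun z => Complex.exp (w * z) * inner ℂ u (resolvent H z v)) a b c d
      = 2 * Real.pi * Complex.I * inner ℂ u (NormedSpace.exp (w • H) v) := by
  set S := spectrum ℂ H with hS
  set X : C(S, ℂ) := (ContinuousMap.id ℂ).restrict S with hX
  set φ : C(S, ℂ) →⋆ₐ[ℂ] (E →L[ℂ] E) := cfcHom hH with hφ
  have hφc : Continuous φ := cfcHom_continuous hH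
  let L : C(S, ℂ) →L[ℂ] ℂ :=
    { toFun := fun f => inner ℂ u (φ f v)
      map_add' := fun f g => by simp
      map_smul' := fun r f => by simp
      cont := (continuous_const.inner (hφc.clm_apply continuous_const)) }
  have hL : ∀ f, L f = inner ℂ u (φ f v) := fun _ => rfl
  have hre : ∀ {p v : ℂ} {r : ℝ}, (p + r * v) ∈ S → (p + r * v).im = 0 ∧ 
      a < (p + r * v).re ∧ (p + r * v).re < b := by
    intro p v r h
    obtain ⟨x, hx, h⟩ := hσ h
    rw [← h]
    exact ⟨by simp, by simpa using hx.1, by simpa using hx.2⟩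
  -- The contour integral is taken in $C(\sigma(H))$, where evaluations determine it; the continuous
  -- functional `L` then transfers it to matrix elements.
  let G : ℂ → C(S, ℂ) := fun z => Complex.exp (w * z) • resolvent X z
  have hGL : ∀ z ∉ S, L (G z) = Complex.exp (w * z) * inner ℂ u (resolvent H z v) := by
    intro z hz
    rw [hL, map_smul, hφ, cfcHom_resolvent hH hz]
    simp
  have hGx : ∀ z ∉ S, ∀ x : S, G z x = Complex.exp (w * z) * (z - x)⁻¹ := by
    intro z hz x
    rw [← resolvent_restrict_id_apply hz x]
    rfl
  have hGi : ∀ (p v : ℂ) (s t : ℝ), (∀ r : ℝ, p + r * v ∉ S) →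
      IntervalIntegrable (fun r : ℝ => G (p + r * v)) MeasureTheory.volume s t := by
    intro p v s t h
    refine ContinuousOn.intervalIntegrable ?_
    refine ContinuousOn.smul (f := fun r : ℝ => Complex.exp (w * (p + r * v)))
      (g := fun r : ℝ => resolvent X (p + r * v)) (by fun_prop) ?_
    have hγ : Continuous fun r : ℝ => p + r * v := by fun_prop
    refine (continuousOn_resolvent X (s := Sᶜ) ?_).comp hγ.continuousOn fun r _ => h r
    rw [hX, spectrum_restrict_id]
    exact disjoint_compl_left
  have hLint : ∀ (p v' : ℂ) (s t : ℝ), (∀ r : ℝ, p + r * v' ∉ S) →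
      (∫ r : ℝ in s..t, Complex.exp (w * (p + r * v')) * inner ℂ u (resolvent H (p + r * v') v))
        = L (∫ r : ℝ in s..t, G (p + r * v')) := by
    intro p v' s t h
    rw [← L.intervalIntegral_comp_comm (hGi p v' s t h)]
    exact intervalIntegral.integral_congr fun r _ => (hGL _ (h r)).symm
  have hxint : ∀ (x : S) (p v' : ℂ) (s t : ℝ), (∀ r : ℝ, p + r * v' ∉ S) →
      (∫ r : ℝ in s..t, Complex.exp (w * (p + r * v')) * (p + r * v' - x)⁻¹)
        = (∫ r : ℝ in s..t, G (p + r * v')) x := by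
    intro x p v' s t h
    have := (ContinuousMap.evalCLM ℂ x : C(S, ℂ) →L[ℂ] ℂ).intervalIntegral_comp_comm
      (hGi p v' s t h)
    refine Eq.trans ?_ this
    exact intervalIntegral.integral_congr fun r _ => (hGx _ (h r) x).symm
  have e1 : ∀ e : ℝ, e ≠ 0 → ∀ r : ℝ, (e * Complex.I + r * 1 : ℂ) ∉ S := fun e he r h =>
    he (by simpa using (hre h).1)
  have e2 : ∀ r : ℝ, (b + r * Complex.I : ℂ) ∉ S := fun r h => by
    simpa using (hre h).2.2
  have e3 : ∀ r : ℝ, (a + r * Complex.I : ℂ) ∉ S := fun r h => by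
    simpa using (hre h).2.1
  let +nondep : Algebra ℚ (E →L[ℂ] E) := .restrictScalars ℚ ℂ _
  have hexp : φ (NormedSpace.exp (w • X)) = NormedSpace.exp (w • H) := by
    rw [NormedSpace.map_exp φ hφc, map_smul, hφ, cfcHom_id]
  have hI : (∫ r : ℝ in a..b, G (c * Complex.I + r * 1))
      - (∫ r : ℝ in a..b, G (d * Complex.I + r * 1))
      + Complex.I • (∫ r : ℝ in c..d, G (b + r * Complex.I))
      - Complex.I • (∫ r : ℝ in c..d, G (a + r * Complex.I))
      = (2 * Real.pi * Complex.I : ℂ) • NormedSpace.exp (w • X) := by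
    -- At each point of the spectrum this is the scalar Cauchy formula for $e^{wz}$.
    ext x
    obtain ⟨y, hy, hyx⟩ := hσ x.2
    have hcau := rectIntegral_cauchy hy.1 hy.2 hc hd (F := fun z => Complex.exp (w * z))
      (by fun_prop)
    simp only at hyx
    rw [hyx, rectIntegral_eq] at hcau
    rw [hxint x _ _ _ _ (e1 c hc.ne), hxint x _ _ _ _ (e1 d hd.ne'), hxint x _ _ _ _ e2,
      hxint x _ _ _ _ e3] at hcau
    rw [NormedSpace.exp_continuousMap_eq]
    simpa [Complex.exp_eq_exp_ℂ, hX] using hcau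
  rw [rectIntegral_eq, hLint _ _ _ _ (e1 c hc.ne), hLint _ _ _ _ (e1 d hd.ne'),
    hLint _ _ _ _ e2, hLint _ _ _ _ e3, ← map_sub, ← map_smul, ← map_smul, ← map_add, ← map_sub,
    hI, map_smul, hL, hexp, smul_eq_mul]

end Resolvent

/-! ### Jacobi operators on $\ell^2(\mathbb Z)$ -/

lemma inner_delta (n : ℤ) (ψ : EllTwo) : inner ℂ (delta n) ψ = ψ n := by
  rw [delta, lp.inner_single_left]
  simp

lemma delta_apply (n m : ℤ) : delta n m = if m = n then 1 else 0 := by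
  rw [delta, lp.single_apply, Pi.single_apply]

lemma norm_delta (n : ℤ) : ‖delta n‖ = 1 := by
  rw [delta, lp.norm_single (by norm_num), norm_one]

lemma norm_apply_le (ψ : EllTwo) (n : ℤ) : ‖ψ n‖ ≤ ‖ψ‖ :=
  lp.norm_apply_le_norm (by norm_num) ψ n

lemma sum_norm_sq_le (ψ : EllTwo) (s : Finset ℤ) : ∑ n ∈ s, ‖ψ n‖ ^ 2 ≤ ‖ψ‖ ^ 2 := by
  have := lp.sum_rpow_le_norm_rpow (p := 2) (by norm_num) ψ s
  simpa using this

lemma weightedShift_apply (c : ℤ → ℝ) (hc : ∃ C : ℝ, ∀ n, |c n| ≤ C) (k : ℤ) (ψ : EllTwo) (n : ℤ) :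
    weightedShift c hc k ψ n = (c n : ℂ) * ψ (n + k) := rfl

lemma norm_weightedShift_le {c : ℤ → ℝ} {C : ℝ} (hC : ∀ n, |c n| ≤ C) (k : ℤ) (ψ : EllTwo) :
    ‖weightedShift c ⟨C, hC⟩ k ψ‖ ≤ C * ‖ψ‖ :=
  (weightedShift_memlp_and_norm hC k ψ).2

lemma inner_weightedShift (c : ℤ → ℝ) (hc : ∃ C : ℝ, ∀ n, |c n| ≤ C) (k : ℤ) (φ ψ : EllTwo) :
    inner ℂ φ (weightedShift c hc k ψ)
      = inner ℂ (weightedShift (fun n => c (n - k)) (hc.imp fun _ h n => h (n - k)) (-k) φ) ψ := by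
  rw [lp.inner_eq_tsum, lp.inner_eq_tsum]
  refine Eq.trans (tsum_congr fun n => ?_) ((Equiv.addRight k).tsum_eq _)
  simp only [Equiv.coe_addRight, weightedShift_apply, add_sub_cancel_right, add_neg_cancel_right,
    RCLike.inner_apply, map_mul, Complex.conj_ofReal]
  ring

lemma isSelfAdjoint_jacobiOperator (a b : ℤ → ℝ) (ha : ∃ C : ℝ, ∀ n, |a n| ≤ C)
    (hb : ∃ C : ℝ, ∀ n, |b n| ≤ C) : IsSelfAdjoint (jacobiOperator a b ha hb) := by
  rw [ContinuousLinearMap.isSelfAdjoint_iff_isSymmetric]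
  intro φ ψ
  simp only [ContinuousLinearMap.coe_coe, jacobiOperator, add_apply,
    inner_add_left, inner_add_right, inner_weightedShift _ _ _ φ]
  simp only [sub_neg_eq_add, add_sub_cancel_right, neg_neg, sub_zero, neg_zero]
  ring

lemma norm_resolvent_le_of_im {E : Type*} [NormedAddCommGroup E] [InnerProductSpace ℂ E]
    [CompleteSpace E] {H : E →L[ℂ] E} (hH : IsSelfAdjoint H) {z : ℂ} (hz : 0 < z.im) :
    ‖resolvent H z‖ ≤ z.im⁻¹ := by
  refine norm_resolvent_le hH.isStarNormal hz fun x hx => ?_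
  have := Complex.abs_im_le_norm (z - x)
  rw [Complex.sub_im, hH.im_eq_zero_of_mem_spectrum hx, sub_zero] at this
  exact (le_abs_self _).trans this

lemma notMem_spectrum_of_im {E : Type*} [NormedAddCommGroup E] [InnerProductSpace ℂ E]
    [CompleteSpace E] {H : E →L[ℂ] E} (hH : IsSelfAdjoint H) {z : ℂ} (hz : 0 < z.im) :
    z ∉ spectrum ℂ H := fun h => hz.ne' (hH.im_eq_zero_of_mem_spectrum h)

lemma resolvent_apply_eq {E : Type*} [NormedAddCommGroup E] [NormedSpace ℂ E]
    {H : E →L[ℂ] E} {z : ℂ} (hz : z ∉ spectrum ℂ H) {ψ φ : E} (h : z • ψ - H ψ = φ) :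
    resolvent H z φ = ψ := by
  have := congrArg (fun T : E →L[ℂ] E => T ψ) (resolvent_mul_of_notMem hz)
  rw [← h]
  simpa [Algebra.algebraMap_eq_smul_one] using this

lemma smul_sub_resolvent_apply {E : Type*} [NormedAddCommGroup E] [NormedSpace ℂ E]
    {H : E →L[ℂ] E} {z : ℂ} (hz : z ∉ spectrum ℂ H) (φ : E) :
    z • resolvent H z φ - H (resolvent H z φ) = φ := by
  have := congrArg (fun T : E →L[ℂ] E => T φ) (mul_resolvent_of_notMem hz)
  simpa [Algebra.algebraMap_eq_smul_one] using this

/-! ### Exponential decay of the resolvent kernel -/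

lemma abs_one_sub_exp_sub_le {η x y : ℝ} (h : |x - y| ≤ η) :
    |1 - Real.exp x / Real.exp y| ≤ Real.exp η - 1 := by
  rw [← Real.exp_sub]
  obtain ⟨h1, h2⟩ := abs_le.1 h
  have h3 := Real.exp_le_exp.2 h1
  have h4 := Real.exp_le_exp.2 h2
  have h5 : 0 < Real.exp η := Real.exp_pos η
  have h6 : Real.exp (-η) * Real.exp η = 1 := by rw [← Real.exp_add]; simp
  rw [abs_le]
  constructor
  · linarith
  · nlinarith [sq_nonneg (Real.exp η - 1)]

/-- Combes–Thomas estimate. -/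
lemma norm_resolvent_delta_le {a b : ℤ → ℝ} {Λ η : ℝ} (ha : ∀ n, |a n| ≤ Λ)
    (hb : ∃ C : ℝ, ∀ n, |b n| ≤ C) (hη : 0 ≤ η) (hΛη : 2 * Λ * (Real.exp η - 1) ≤ 1 / 2)
    {z : ℂ} (hz : z ∉ spectrum ℂ (jacobiOperator a b ⟨Λ, ha⟩ hb))
    (hR : ‖resolvent (jacobiOperator a b ⟨Λ, ha⟩ hb) z‖ ≤ 1) (m n : ℤ) :
    ‖resolvent (jacobiOperator a b ⟨Λ, ha⟩ hb) z (delta m) n‖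
      ≤ 2 * Real.exp (-η * |(n : ℝ) - m|) := by
  set H := jacobiOperator a b ⟨Λ, ha⟩ hb with hH
  set u := resolvent H z (delta m) with hu
  -- The weight exponent is truncated at its value at the target site `n`: the multiplication
  -- operator `D` by $e^{w}$ is then bounded, while nothing is lost at `n`. Truncation keeps $w$
  -- Lipschitz with constant $\eta$.
  set w : ℤ → ℝ := fun j => η * min |(j : ℝ) - m| |(n : ℝ) - m| with hw
  have hΛ : 0 ≤ Λ := (abs_nonneg _).trans (ha 0)
  have hw0 : ∀ j, 0 ≤ w j := fun j => by positivity
  have hwlip : ∀ i j : ℤ, |i - j| ≤ 1 → |w i - w j| ≤ η := by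
    intro i j hij
    rw [hw]
    simp only
    rw [← mul_sub, abs_mul, abs_of_nonneg hη]
    refine mul_le_of_le_one_right hη ?_
    refine (abs_min_sub_min_le_max _ _ _ _).trans ?_
    rw [sub_self, abs_zero]
    refine max_le ((abs_abs_sub_abs_le _ _).trans ?_) zero_le_one
    rw [sub_sub_sub_cancel_right]
    exact_mod_cast hij
  let D : EllTwo →L[ℂ] EllTwo := weightedShift (fun j => Real.exp (w j))
    ⟨Real.exp (η * |(n : ℝ) - m|), fun j => by
      rw [abs_of_pos (Real.exp_pos _), Real.exp_le_exp]
      exact mul_le_mul_of_nonneg_left (min_le_right _ _) hη⟩ 0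
  have hc : ∀ k e : ℤ, |k| ≤ 1 → ∀ j, |a (j + e) * (1 - Real.exp (w j) / Real.exp (w (j + k)))|
      ≤ Λ * (Real.exp η - 1) := by
    intro k e hk j
    rw [abs_mul]
    exact mul_le_mul (ha _) (abs_one_sub_exp_sub_le (hwlip _ _ (by simpa using hk)))
      (abs_nonneg _) hΛ
  let B₁ := weightedShift _ ⟨_, hc 1 0 (by simp)⟩ 1
  let B₂ := weightedShift _ ⟨_, hc (-1) (-1) (by simp)⟩ (-1)
  have hDu : ∀ j, D u j = Real.exp (w j) * u j := fun j => by
    rw [weightedShift_apply, add_zero]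
  have heq : ∀ j, z * u j - ((a j : ℂ) * u (j + 1) + (a (j - 1) : ℂ) * u (j - 1) + (b j : ℂ) * u j)
      = delta m j := by
    intro j
    have h : z * u j - H u j = delta m j :=
      congrArg (fun f : EllTwo => f j) (smul_sub_resolvent_apply hz (delta m))
    rwa [hH, jacobiOperator_apply] at h
  -- Conjugation by the weight perturbs the equation only through the commutator with the hopping.
  -- Each of `B₁`, `B₂` has norm at most $\Lambda(e^\eta-1)\le 1/4$, so the perturbation can be
  -- absorbed. The source is unchanged since $w(m)=0$.
  have hsolve : z • D u - H (D u) = delta m - (B₁ (D u) + B₂ (D u)) := by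
    ext j
    have hj := heq j
    have hd : (Real.exp (w j) : ℂ) * delta m j = delta m j := by
      rw [delta_apply]
      split_ifs with h
      · have : w j = 0 := by rw [hw, h]; simp
        rw [this]
        simp
      · simp
    have hB₁ : B₁ (D u) j = (a j : ℂ) * (Real.exp (w (j + 1)) - Real.exp (w j)) * u (j + 1) := by
      rw [weightedShift_apply, hDu, add_zero]
      have : (Real.exp (w (j + 1)) : ℂ) ≠ 0 := by exact_mod_cast (Real.exp_pos _).ne'
      push_cast at this ⊢
      field_simp
    have hB₂ : B₂ (D u) j
        = (a (j - 1) : ℂ) * (Real.exp (w (j - 1)) - Real.exp (w j)) * u (j - 1) := by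
      rw [weightedShift_apply, hDu, ← sub_eq_add_neg]
      have : (Real.exp (w (j - 1)) : ℂ) ≠ 0 := by exact_mod_cast (Real.exp_pos _).ne'
      push_cast at this ⊢
      field_simp
    have hl : (z • D u - H (D u)) j = z * D u j - H (D u) j := rfl
    have hr : (delta m - (B₁ (D u) + B₂ (D u))) j = delta m j - (B₁ (D u) j + B₂ (D u) j) := rfl
    rw [hl, hr, hB₁, hB₂, hH, jacobiOperator_apply, hDu, hDu, hDu]
    linear_combination (Real.exp (w j) : ℂ) * hj + hd
  have hnorm : ‖D u‖ ≤ 2 := by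
    have h1 : ‖D u‖ ≤ 1 * ‖delta m - (B₁ (D u) + B₂ (D u))‖ := by
      rw [← resolvent_apply_eq hz hsolve]
      exact (ContinuousLinearMap.le_opNorm _ _).trans
        (mul_le_mul_of_nonneg_right hR (norm_nonneg _)) |>.trans_eq
          (by rw [resolvent_apply_eq hz hsolve])
    have h2 := norm_sub_le (delta m) (B₁ (D u) + B₂ (D u))
    have h3 := norm_add_le (B₁ (D u)) (B₂ (D u))
    have h4 : ‖B₁ (D u)‖ ≤ _ := norm_weightedShift_le (hc 1 0 (by simp)) 1 (D u)
    have h5 : ‖B₂ (D u)‖ ≤ _ := norm_weightedShift_le (hc (-1) (-1) (by simp)) (-1) (D u)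
    rw [norm_delta] at h2
    have h6 := mul_le_mul_of_nonneg_right hΛη (norm_nonneg (D u))
    linarith
  have hn := (norm_apply_le (D u) n).trans hnorm
  rw [hDu, norm_mul, Complex.norm_real, Real.norm_of_nonneg (Real.exp_pos _).le] at hn
  have hwn : w n = η * |(n : ℝ) - m| := by rw [hw]; simp
  rw [hwn] at hn
  rw [neg_mul, Real.exp_neg, ← div_eq_mul_inv, le_div_iff₀ (Real.exp_pos _), mul_comm]
  exact hn

/-! ### Transfer matrices -/

lemma l2_opNorm_sq_le_sum_norm_sq (A : Matrix (Fin 2) (Fin 2) ℂ) :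
    ‖A‖ ^ 2 ≤ ‖A 0 0‖ ^ 2 + ‖A 0 1‖ ^ 2 + (‖A 1 0‖ ^ 2 + ‖A 1 1‖ ^ 2) := by
  set F := ‖A 0 0‖ ^ 2 + ‖A 0 1‖ ^ 2 + (‖A 1 0‖ ^ 2 + ‖A 1 1‖ ^ 2) with hF
  have hF0 : 0 ≤ F := by positivity
  suffices h : ‖A‖ ≤ Real.sqrt F by
    calc ‖A‖ ^ 2 ≤ Real.sqrt F ^ 2 := by gcongr
      _ = F := Real.sq_sqrt hF0
  rw [Matrix.cstar_norm_def]
  refine ContinuousLinearMap.opNorm_le_bound _ (Real.sqrt_nonneg _) fun x => ?_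
  rw [EuclideanSpace.norm_eq, EuclideanSpace.norm_eq x, ← Real.sqrt_mul hF0]
  refine Real.sqrt_le_sqrt ?_
  have key : ∀ a b x y : ℂ, ‖a * x + b * y‖ ^ 2 ≤ (‖a‖ ^ 2 + ‖b‖ ^ 2) * (‖x‖ ^ 2 + ‖y‖ ^ 2) := by
    intro a b x y
    have h := norm_add_le (a * x) (b * y)
    rw [norm_mul, norm_mul] at h
    nlinarith [sq_nonneg (‖a‖ * ‖y‖ - ‖b‖ * ‖x‖), norm_nonneg (a * x + b * y)]
  have hx : ∀ i, (Matrix.toEuclideanCLM (n := Fin 2) (𝕜 := ℂ) A) x i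
      = A i 0 * x 0 + A i 1 * x 1 := by
    intro i
    rw [Matrix.ofLp_toEuclideanCLM, Matrix.mulVec, dotProduct, Fin.sum_univ_two]
  simp only [Fin.sum_univ_two, hx]
  have h0 := key (A 0 0) (A 0 1) (x 0) (x 1)
  have h1 := key (A 1 0) (A 1 1) (x 0) (x 1)
  rw [hF]
  linarith

lemma transferMatrix_succ (a : ℤ → ℝ) (n : ℕ) (z : ℂ) :
    transferMatrix a (n + 1) z = stepMatrix a ((n : ℤ) + 1) z * transferMatrix a n z := rfl

lemma det_transferMatrix {a : ℤ → ℝ} (ha : ∀ n, a n ≠ 0) (n : ℕ) (z : ℂ) :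
    (transferMatrix a n z).det = 1 := by
  induction n with
  | zero => exact Matrix.det_one
  | succ n ih =>
    rw [transferMatrix_succ, Matrix.det_mul, ih, stepMatrix, Matrix.det_smul, Matrix.det_fin_two]
    have : (a (n + 1) : ℂ) ≠ 0 := by exact_mod_cast ha _
    simp
    field_simp

lemma transferMatrix_congr {a a' : ℤ → ℝ} (h : ∀ n : ℤ, 1 ≤ n → a n = a' n) (n : ℕ) (z : ℂ) :
    transferMatrix a n z = transferMatrix a' n z := by
  induction n with
  | zero => rfl
  | succ n ih => rw [transferMatrix_succ, transferMatrix_succ, ih, stepMatrix, stepMatrix,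
      h _ (by lia)]

/-- This reduces norm bounds to first rows: those of two consecutive matrices control the later one
entirely. -/
lemma transferMatrix_succ_row_one {a : ℤ → ℝ} (ha : ∀ n, a n ≠ 0) (n : ℕ) (z : ℂ) (j : Fin 2) :
    transferMatrix a (n + 1) z 1 j = a (n + 1) * transferMatrix a n z 0 j := by
  have : (a (n + 1) : ℂ) ≠ 0 := by exact_mod_cast ha _
  rw [transferMatrix_succ, Matrix.mul_apply, Fin.sum_univ_two, stepMatrix]
  simp
  left
  field_simp

/-- In use, `x n` is $\psi(n+1)$ and `y n` is $a(n)\psi(n)$ up to a source correction at $n=0$. Only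
steps below `k` are assumed, since the equation changes at the cut. -/
lemma mulVec_transferMatrix {a : ℤ → ℝ} (ha : ∀ n, a n ≠ 0) {z : ℂ} {x y : ℕ → ℂ} {k : ℕ}
    (hx : ∀ n < k, a (n + 1) * x (n + 1) + y n = z * x n)
    (hy : ∀ n < k, y (n + 1) = a (n + 1) * x n) :
    ∀ n ≤ k, x n = transferMatrix a n z 0 0 * x 0 + transferMatrix a n z 0 1 * y 0 ∧
      y n = transferMatrix a n z 1 0 * x 0 + transferMatrix a n z 1 1 * y 0 := by
  intro n
  induction n with
  | zero => simp [transferMatrix]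
  | succ n ih =>
    intro hn
    obtain ⟨h0, h1⟩ := ih (by lia)
    have hne : (a (n + 1) : ℂ) ≠ 0 := by exact_mod_cast ha _
    have hxn := hx n hn
    constructor
    · have e : ∀ j, transferMatrix a (n + 1) z 0 j
          = (a (n + 1) : ℂ)⁻¹ * (z * transferMatrix a n z 0 j - transferMatrix a n z 1 j) := by
        intro j
        rw [transferMatrix_succ, Matrix.mul_apply, Fin.sum_univ_two, stepMatrix]
        simp
        ring
      rw [e, e]
      field_simp
      linear_combination hxn + z * h0 - h1
    · rw [transferMatrix_succ_row_one ha, transferMatrix_succ_row_one ha, hy n hn, h0]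
      ring

/-- With determinant one the inverse is explicit, and the preimage of $(0,w)$ is
$(-A_{01}w,A_{00}w)$: the first row times $w$ is exactly the initial data. -/
lemma first_row_bound {A : Matrix (Fin 2) (Fin 2) ℂ} (hA : A.det = 1) {x y w : ℂ}
    (h0 : A 0 0 * x + A 0 1 * y = 0) (h1 : A 1 0 * x + A 1 1 * y = w) {c : ℝ}
    (hx : ‖x‖ ≤ c) (hy : ‖y‖ ≤ c) :
    (‖A 0 0‖ ^ 2 + ‖A 0 1‖ ^ 2) * ‖w‖ ^ 2 ≤ 2 * c ^ 2 := by
  rw [Matrix.det_fin_two] at hA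
  have e1 : x = -(A 0 1 * w) := by linear_combination (-x) * hA + A 1 1 * h0 - A 0 1 * h1
  have e2 : y = A 0 0 * w := by linear_combination (-y) * hA + A 0 0 * h1 - A 1 0 * h0
  rw [e1, norm_neg, norm_mul] at hx
  rw [e2, norm_mul] at hy
  have h2 := mul_self_le_mul_self (by positivity) hx
  have h3 := mul_self_le_mul_self (by positivity) hy
  nlinarith

/-! ### Cutting a bond and bounding the resolvent tail -/

/-- Cutting the bond between `k` and `k + 1`. -/
def cutBond (a : ℤ → ℝ) (k : ℤ) (n : ℤ) : ℝ := if n = k then 0 else a n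

lemma cutBond_bounded {a : ℤ → ℝ} {Λ : ℝ} (ha : ∀ n, |a n| ≤ Λ) (k n : ℤ) :
    |cutBond a k n| ≤ Λ := by
  unfold cutBond
  split_ifs
  · simpa using (abs_nonneg _).trans (ha 0)
  · exact ha n

/-- The Jacobi operator with vanishing diagonal. -/
def hoppingOperator (a : ℤ → ℝ) (ha : ∃ C : ℝ, ∀ n, |a n| ≤ C) : EllTwo →L[ℂ] EllTwo :=
  jacobiOperator a (fun _ => 0) ha ⟨0, fun _ => by simp⟩

lemma hoppingOperator_apply (a : ℤ → ℝ) (ha : ∃ C : ℝ, ∀ n, |a n| ≤ C) (ψ : EllTwo) (n : ℤ) :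
    hoppingOperator a ha ψ n = (a n : ℂ) * ψ (n + 1) + (a (n - 1) : ℂ) * ψ (n - 1) := by
  rw [hoppingOperator, jacobiOperator_apply]
  simp

lemma isSelfAdjoint_hoppingOperator (a : ℤ → ℝ) (ha : ∃ C : ℝ, ∀ n, |a n| ≤ C) :
    IsSelfAdjoint (hoppingOperator a ha) := isSelfAdjoint_jacobiOperator _ _ _ _

lemma resolvent_hoppingOperator_recurrence (a : ℤ → ℝ) (ha : ∃ C : ℝ, ∀ n, |a n| ≤ C) {z : ℂ}
    (hz : 0 < z.im) (φ : EllTwo) (n : ℤ) :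
    z * resolvent (hoppingOperator a ha) z φ n
      - ((a n : ℂ) * resolvent (hoppingOperator a ha) z φ (n + 1)
        + (a (n - 1) : ℂ) * resolvent (hoppingOperator a ha) z φ (n - 1)) = φ n := by
  have h : z * resolvent (hoppingOperator a ha) z φ n
      - hoppingOperator a ha (resolvent (hoppingOperator a ha) z φ) n = φ n :=
    congrArg (fun f : EllTwo => f n) (smul_sub_resolvent_apply
      (notMem_spectrum_of_im (isSelfAdjoint_hoppingOperator a ha) hz) φ)
  rwa [hoppingOperator_apply] at h

lemma resolvent_hoppingOperator_eq (a : ℤ → ℝ) (ha : ∃ C : ℝ, ∀ n, |a n| ≤ C) {z : ℂ}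
    (hz : 0 < z.im) {ψ φ : EllTwo}
    (h : ∀ n, z * ψ n - ((a n : ℂ) * ψ (n + 1) + (a (n - 1) : ℂ) * ψ (n - 1)) = φ n) :
    resolvent (hoppingOperator a ha) z φ = ψ := by
  refine resolvent_apply_eq (notMem_spectrum_of_im (isSelfAdjoint_hoppingOperator a ha) hz) ?_
  ext n
  refine Eq.trans ?_ (h n)
  rw [← hoppingOperator_apply a ha]
  rfl

lemma norm_resolvent_delta_le_inv {E : EllTwo →L[ℂ] EllTwo} (hE : IsSelfAdjoint E) {z : ℂ}
    (hz : 0 < z.im) (n : ℤ) : ‖resolvent E z (delta n)‖ ≤ z.im⁻¹ := by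
  have h := (resolvent E z).le_opNorm (delta n)
  rw [norm_delta, mul_one] at h
  exact h.trans (norm_resolvent_le_of_im hE hz)

/-- The cut decouples the half-lines and the source lies on the left. Restricting the vector to the
right half-line thus solves the equation with zero source, whose only solution is zero. -/
lemma resolvent_cutBond_eq_zero {a : ℤ → ℝ} {Λ : ℝ} (ha : ∀ n, |a n| ≤ Λ) {z : ℂ}
    (hz : 0 < z.im) {s k : ℤ} (hsk : s ≤ k) {n : ℤ} (hn : k < n) :
    resolvent (hoppingOperator (cutBond a k) ⟨Λ, cutBond_bounded ha k⟩) z (delta s) n = 0 := by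
  set H := hoppingOperator (cutBond a k) ⟨Λ, cutBond_bounded ha k⟩ with hH
  set v := resolvent H z (delta s) with hv
  let χ : EllTwo →L[ℂ] EllTwo := weightedShift (fun j => if k < j then 1 else 0)
    ⟨1, fun j => by split_ifs <;> simp⟩ 0
  have hχ : ∀ j, χ v j = if k < j then v j else 0 := by
    intro j
    rw [weightedShift_apply, add_zero]
    split_ifs <;> simp
  have h0 : resolvent H z 0 = χ v := by
    refine resolvent_hoppingOperator_eq _ _ hz fun j => ?_
    have hj := resolvent_hoppingOperator_recurrence _ ⟨Λ, cutBond_bounded ha k⟩ hz (delta s) j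
    rw [← hH, ← hv, delta_apply] at hj
    rw [hχ, hχ, hχ]
    rcases lt_trichotomy j k with h | h | h
    · rw [if_neg (by lia), if_neg (by lia), if_neg (by lia)]
      simp
    · subst h
      simp [cutBond]
    · rw [if_neg (by lia : ¬ j = s)] at hj
      rw [if_pos h, if_pos (by lia)]
      split_ifs with h'
      · exact hj
      · have : cutBond a k (j - 1) = 0 := by
          rw [cutBond, if_pos (by lia)]
        rw [this] at hj ⊢
        simpa using hj
  rw [map_zero] at h0
  have := hχ n
  rw [if_pos hn, ← h0] at this
  exact this.symm

/-- The geometric resolvent identity: restoring the bond changes the equation for the cut vector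
only at site $k+1$, because that vector already vanishes there. -/
lemma resolvent_eq_cutBond_add {a : ℤ → ℝ} {Λ : ℝ} (ha : ∀ n, |a n| ≤ Λ) {z : ℂ}
    (hz : 0 < z.im) {s k : ℤ} (hsk : s ≤ k) :
    resolvent (hoppingOperator a ⟨Λ, ha⟩) z (delta s)
      = resolvent (hoppingOperator (cutBond a k) ⟨Λ, cutBond_bounded ha k⟩) z (delta s)
        + ((a k : ℂ) * resolvent (hoppingOperator (cutBond a k) ⟨Λ, cutBond_bounded ha k⟩) z
            (delta s) k) • resolvent (hoppingOperator a ⟨Λ, ha⟩) z (delta (k + 1)) := by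
  set v := resolvent (hoppingOperator (cutBond a k) ⟨Λ, cutBond_bounded ha k⟩) z (delta s) with hv
  set r := resolvent (hoppingOperator a ⟨Λ, ha⟩) z (delta (k + 1)) with hr
  refine resolvent_hoppingOperator_eq _ _ hz fun j => ?_
  have hj := resolvent_hoppingOperator_recurrence _ ⟨Λ, cutBond_bounded ha k⟩ hz (delta s) j
  have hj' := resolvent_hoppingOperator_recurrence _ ⟨Λ, ha⟩ hz (delta (k + 1)) j
  rw [← hv] at hj
  rw [← hr, delta_apply (k + 1)] at hj'
  have hvk : v (k + 1) = 0 := resolvent_cutBond_eq_zero ha hz hsk (by lia)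
  have hadd : ∀ i, (v + ((a k : ℂ) * v k) • r) i = v i + (a k : ℂ) * v k * r i := fun _ => rfl
  rw [hadd, hadd, hadd]
  by_cases h1 : j = k
  · subst h1
    rw [if_neg (by lia)] at hj'
    rw [hvk] at hj ⊢
    have : cutBond a j (j - 1) = a (j - 1) := by rw [cutBond, if_neg (by lia)]
    rw [this] at hj
    linear_combination hj + a j * v j * hj'
  · have e : cutBond a k j = a j := by rw [cutBond, if_neg h1]
    rw [e] at hj
    by_cases h2 : j = k + 1
    · subst h2
      rw [if_pos rfl] at hj'
      have : cutBond a k (k + 1 - 1) = 0 := by rw [cutBond, if_pos (by lia)]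
      rw [this, Complex.ofReal_zero] at hj
      rw [add_sub_cancel_right] at hj hj' ⊢
      linear_combination hj + a k * v k * hj'
    · rw [if_neg h2] at hj'
      have : cutBond a k (j - 1) = a (j - 1) := by rw [cutBond, if_neg (by lia)]
      rw [this] at hj
      linear_combination hj + a k * v k * hj'

lemma first_row_mul_sum_resolvent_le {a : ℤ → ℝ} {Λ : ℝ} (ha : ∀ n, |a n| ≤ Λ)
    (ha0 : ∀ n, a n ≠ 0) {z : ℂ} (hz : 0 < z.im) (hz1 : z.im ≤ 1) {s : ℤ} (hs : s ≤ 1) (k : ℕ)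
    {F : Finset ℤ} (hF : ∀ n ∈ F, (k : ℤ) < n) :
    (‖transferMatrix a k z 0 0‖ ^ 2 + ‖transferMatrix a k z 0 1‖ ^ 2)
        * ∑ n ∈ F, ‖resolvent (hoppingOperator a ⟨Λ, ha⟩) z (delta s) n‖ ^ 2
      ≤ 2 * (Λ + 1) ^ 2 * (z.im⁻¹) ^ 4 := by
  have hΛ : 0 ≤ Λ := (abs_nonneg _).trans (ha 0)
  have hinv : 1 ≤ z.im⁻¹ := (one_le_inv₀ hz).2 hz1
  set ρ := z.im⁻¹ with hρ
  have hsum : ∀ m, ∑ n ∈ F, ‖resolvent (hoppingOperator a ⟨Λ, ha⟩) z (delta m) n‖ ^ 2 ≤ ρ ^ 2 := by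
    intro m
    refine (sum_norm_sq_le _ F).trans ?_
    have := norm_resolvent_delta_le_inv (isSelfAdjoint_hoppingOperator a ⟨Λ, ha⟩) hz m
    gcongr
  have hρ4 : ρ ^ 2 ≤ ρ ^ 4 := pow_le_pow_right₀ hinv (by norm_num)
  -- For $k=0$ a source at site 1 would lie right of the cut, but $\Phi(0,z)=1$ and the trivial
  -- resolvent bound suffices.
  rcases Nat.eq_zero_or_pos k with rfl | hk
  · have : ‖transferMatrix a 0 z 0 0‖ ^ 2 + ‖transferMatrix a 0 z 0 1‖ ^ 2 = 1 := by
      simp [transferMatrix]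
    rw [this, one_mul]
    have := hsum s
    nlinarith [pow_nonneg (zero_le_one.trans hinv) 4, mul_nonneg hΛ (pow_nonneg (zero_le_one.trans hinv) 4),
      mul_nonneg (mul_nonneg hΛ hΛ) (pow_nonneg (zero_le_one.trans hinv) 4)]
  have hsk : s ≤ (k : ℤ) := by lia
  have hdec := resolvent_eq_cutBond_add ha hz hsk
  set v := resolvent (hoppingOperator (cutBond a k) ⟨Λ, cutBond_bounded ha k⟩) z (delta s) with hv
  have hv0 : ∀ n : ℤ, (k : ℤ) < n → v n = 0 := fun n hn => resolvent_cutBond_eq_zero ha hz hsk hn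
  have hvb : ∀ n, ‖v n‖ ≤ ρ := fun n => (norm_apply_le v n).trans
    (norm_resolvent_delta_le_inv (isSelfAdjoint_hoppingOperator _ _) hz s)
  have hrec := resolvent_hoppingOperator_recurrence _ ⟨Λ, cutBond_bounded ha k⟩ hz (delta s)
  rw [← hv] at hrec
  -- A source at site 1 is absorbed into the initial datum at $n=0$, so the recurrence is
  -- homogeneous from there on. For $s\le0$ the correction is zero.
  let y : ℕ → ℂ := fun n => a n * v n + if n = 0 then delta s 1 else 0
  have hxy := mulVec_transferMatrix ha0 (z := z) (x := fun n : ℕ => v (n + 1)) (y := y) (k := k)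
    (by
      intro n hn
      have h := hrec (n + 1)
      have e1 : cutBond a k ((n : ℤ) + 1 - 1) = a n := by
        rw [add_sub_cancel_right, cutBond, if_neg (by lia)]
      -- The original coefficient may replace the cut one: where they differ, it multiplies
      -- $v(k+1)=0$. The transfer matrices of the uncut sequence therefore apply up to `k`.
      have e2 : (cutBond a k ((n : ℤ) + 1) : ℂ) * v ((n : ℤ) + 1 + 1)
          = a (n + 1) * v ((n : ℤ) + 1 + 1) := by
        rw [cutBond]
        split_ifs with h'
        · rw [hv0 _ (by lia)]; simp
        · rfl
      have e3 : delta s ((n : ℤ) + 1) = if n = 0 then delta s 1 else 0 := by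
        split_ifs with h'
        · subst h'; rfl
        · rw [delta_apply, if_neg (by lia)]
      rw [e1, e2, e3, add_sub_cancel_right] at h
      simp only [y]
      push_cast
      linear_combination -h)
    (by
      intro n hn
      simp [y]) k le_rfl
  simp only [hv0 (k + 1) (by lia)] at hxy
  have hdelta : ‖delta s 1‖ ≤ 1 := by
    rw [delta_apply]
    split_ifs <;> simp
  have hy0 : ‖y 0‖ ≤ (Λ + 1) * ρ := by
    have h1 : ‖y 0‖ ≤ ‖(a 0 : ℂ) * v 0‖ + ‖delta s 1‖ := by
      simpa [y] using norm_add_le ((a 0 : ℂ) * v 0) (delta s 1)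
    rw [norm_mul, Complex.norm_real, Real.norm_eq_abs] at h1
    have := mul_le_mul (ha 0) (hvb 0) (norm_nonneg _) hΛ
    nlinarith
  have hx0 : ‖v ((0 : ℕ) + 1)‖ ≤ (Λ + 1) * ρ := by
    refine (hvb _).trans ?_
    nlinarith
  have hyk : y k = a k * v k := by simp [y, hk.ne']
  have hrow := first_row_bound (det_transferMatrix ha0 k z) hxy.1.symm hxy.2.symm hx0 hy0
  have hterm : ∀ n ∈ F, ‖resolvent (hoppingOperator a ⟨Λ, ha⟩) z (delta s) n‖ ^ 2
      = ‖y k‖ ^ 2 * ‖resolvent (hoppingOperator a ⟨Λ, ha⟩) z (delta (k + 1)) n‖ ^ 2 := by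
    intro n hn
    have hadd : ∀ (c : ℂ) (r : EllTwo), (v + c • r) n = v n + c * r n := fun _ _ => rfl
    rw [hdec, hadd, hv0 n (hF n hn), zero_add, norm_mul, mul_pow, hyk]
  rw [Finset.sum_congr rfl hterm, ← Finset.mul_sum, ← mul_assoc]
  -- One factor $\rho^2$ comes from the initial data of the cut resolvent, the other from the full
  -- resolvent started at $k+1$.
  calc _ ≤ 2 * ((Λ + 1) * ρ) ^ 2 * ρ ^ 2 := by
        gcongr
        exact hsum _
    _ = _ := by ring

/-- The resolvent outside `[.., N]` is controlled by the transfer matrices up to `N`. -/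
lemma norm_transferMatrix_mul_sum_resolvent_le {a : ℤ → ℝ} {Λ : ℝ} (ha : ∀ n, |a n| ≤ Λ)
    (ha0 : ∀ n, a n ≠ 0) {z : ℂ} (hz : 0 < z.im) (hz1 : z.im ≤ 1) {s : ℤ} (hs : s ≤ 1) {k N : ℕ}
    (hk : 1 ≤ k) (hkN : k ≤ N) {F : Finset ℤ} (hF : ∀ n ∈ F, (N : ℤ) < n) :
    ‖transferMatrix a k z‖ ^ 2
        * ∑ n ∈ F, ‖resolvent (hoppingOperator a ⟨Λ, ha⟩) z (delta s) n‖ ^ 2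
      ≤ 2 * (1 + Λ ^ 2) * (Λ + 1) ^ 2 * (z.im⁻¹) ^ 4 := by
  obtain ⟨k, rfl⟩ : ∃ m, k = m + 1 := ⟨k - 1, by lia⟩
  set S := ∑ n ∈ F, ‖resolvent (hoppingOperator a ⟨Λ, ha⟩) z (delta s) n‖ ^ 2 with hS
  have hS0 : 0 ≤ S := by positivity
  have h1 := first_row_mul_sum_resolvent_le ha ha0 hz hz1 hs (k + 1) (F := F)
    fun n hn => by have := hF n hn; push_cast; lia
  have h2 := first_row_mul_sum_resolvent_le ha ha0 hz hz1 hs k (F := F)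
    fun n hn => by have := hF n hn; lia
  have h3 := l2_opNorm_sq_le_sum_norm_sq (transferMatrix a (k + 1) z)
  rw [transferMatrix_succ_row_one ha0, transferMatrix_succ_row_one ha0, norm_mul, norm_mul,
    Complex.norm_real, Real.norm_eq_abs, mul_pow, mul_pow, sq_abs, ← mul_add] at h3
  have h4 : a (k + 1) ^ 2 ≤ Λ ^ 2 := by
    rw [← sq_abs]
    have := ha (k + 1)
    gcongr
  calc _ ≤ _ * S := mul_le_mul_of_nonneg_right h3 hS0
    _ = (‖transferMatrix a (k + 1) z 0 0‖ ^ 2 + ‖transferMatrix a (k + 1) z 0 1‖ ^ 2) * S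
        + a (k + 1) ^ 2
          * ((‖transferMatrix a k z 0 0‖ ^ 2 + ‖transferMatrix a k z 0 1‖ ^ 2) * S) := by ring
    _ ≤ 2 * (Λ + 1) ^ 2 * (z.im⁻¹) ^ 4 + Λ ^ 2 * (2 * (Λ + 1) ^ 2 * (z.im⁻¹) ^ 4) := by gcongr
    _ = _ := by ring

/-- The cut position is free in $1\le k\le N$, so it may be placed at the maximiser, which can
depend on $z$. -/
lemma maxTransferNormSq_mul_sum_resolvent_le {a : ℤ → ℝ} {Λ : ℝ} (ha : ∀ n, |a n| ≤ Λ)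
    (ha0 : ∀ n, a n ≠ 0) {z : ℂ} (hz : 0 < z.im) (hz1 : z.im ≤ 1) {s : ℤ} (hs : s ≤ 1) {N : ℕ}
    (hN : 1 ≤ N) {F : Finset ℤ} (hF : ∀ n ∈ F, (N : ℤ) < n) :
    maxTransferNormSq a N hN z
        * ∑ n ∈ F, ‖resolvent (hoppingOperator a ⟨Λ, ha⟩) z (delta s) n‖ ^ 2
      ≤ 2 * (1 + Λ ^ 2) * (Λ + 1) ^ 2 * (z.im⁻¹) ^ 4 := by
  obtain ⟨k, hk, hmax⟩ := Finset.exists_mem_eq_sup' (Finset.nonempty_Icc.mpr hN)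
    fun n => ‖transferMatrix a n z‖ ^ 2
  rw [Finset.mem_Icc] at hk
  rw [maxTransferNormSq, hmax]
  exact norm_transferMatrix_mul_sum_resolvent_le ha ha0 hz hz1 hs hk.1 hk.2 hF

/-! ### Reflection to the left half-line -/

/-- The reflection `ψ ↦ (n ↦ ψ (-n))`. -/
def reflection (ψ : EllTwo) : EllTwo :=
  ⟨fun n => ψ (-n), by
    have h2 : (0 : ℝ) < (2 : ENNReal).toReal := by norm_num
    exact memℓp_gen ((Equiv.neg ℤ).summable_iff.mpr ((lp.memℓp ψ).summable h2))⟩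

lemma reflection_apply (ψ : EllTwo) (n : ℤ) : reflection ψ n = ψ (-n) := rfl

lemma resolvent_reflection {a : ℤ → ℝ} {Λ : ℝ} (ha : ∀ n, |a n| ≤ Λ) {z : ℂ}
    (hz : 0 < z.im) (s : ℤ) :
    resolvent (hoppingOperator (fun n => a (-n - 1)) ⟨Λ, fun n => ha (-n - 1)⟩) z (delta (-s))
      = reflection (resolvent (hoppingOperator a ⟨Λ, ha⟩) z (delta s)) := by
  refine resolvent_hoppingOperator_eq _ _ hz fun n => ?_
  have h := resolvent_hoppingOperator_recurrence _ ⟨Λ, ha⟩ hz (delta s) (-n)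
  rw [delta_apply] at h ⊢
  simp only [neg_eq_iff_eq_neg, reflection_apply] at h ⊢
  rw [show -(n + 1) = -n - 1 by ring, show -(n - 1) = -n + 1 by ring,
    show -n + 1 - 1 = -n by ring]
  linear_combination h

lemma maxTransferNormSq_mul_sum_resolvent_abs_le {a : ℤ → ℝ} {Λ : ℝ} (ha : ∀ n, |a n| ≤ Λ)
    (ha0 : ∀ n, a n ≠ 0) (hrefl : ∀ n, 1 ≤ n → a (-n - 1) = a n) {z : ℂ} (hz : 0 < z.im)
    (hz1 : z.im ≤ 1) {s : ℤ} (hs : |s| ≤ 1) {N : ℕ} (hN : 1 ≤ N) {F : Finset ℤ}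
    (hF : ∀ n ∈ F, (N : ℤ) < |n|) :
    maxTransferNormSq a N hN z
        * ∑ n ∈ F, ‖resolvent (hoppingOperator a ⟨Λ, ha⟩) z (delta s) n‖ ^ 2
      ≤ 4 * (1 + Λ ^ 2) * (Λ + 1) ^ 2 * (z.im⁻¹) ^ 4 := by
  obtain ⟨hs1, hs2⟩ := abs_le.1 hs
  have h1 := maxTransferNormSq_mul_sum_resolvent_le ha ha0 hz hz1 hs2 hN
    (F := F.filter (0 < ·)) fun n hn => by
      rw [Finset.mem_filter] at hn
      simpa [abs_of_pos hn.2] using hF n hn.1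
  -- Reflection moves the source to $-s$, which still satisfies $-s\le1$. The reflected hopping has
  -- the same transfer matrices, as these involve only indices $n\ge1$.
  have h2 := maxTransferNormSq_mul_sum_resolvent_le (fun n => ha (-n - 1))
    (fun n => ha0 (-n - 1)) hz hz1 (s := -s) (by lia) hN
    (F := (F.filter (¬ 0 < ·)).map (Equiv.neg ℤ).toEmbedding) fun n hn => by
      simp only [Finset.mem_map_equiv, Finset.mem_filter, Equiv.neg_symm, Equiv.neg_apply] at hn
      have := hF _ hn.1
      rwa [abs_of_nonpos (not_lt.1 hn.2), neg_neg] at this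
  have hM : maxTransferNormSq (fun n => a (-n - 1)) N hN z = maxTransferNormSq a N hN z := by
    unfold maxTransferNormSq
    simp only [transferMatrix_congr hrefl]
  rw [hM, resolvent_reflection ha hz, Finset.sum_map] at h2
  simp only [Equiv.coe_toEmbedding, Equiv.neg_apply, reflection_apply, neg_neg] at h2
  rw [← Finset.sum_filter_add_sum_filter_not F (0 < ·), mul_add]
  linarith

/-! ### Continuity and positivity of the transfer maximum -/

lemma continuous_transferMatrix (a : ℤ → ℝ) (n : ℕ) : Continuous (transferMatrix a n) := by
  induction n with
  | zero => exact continuous_const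
  | succ n ih =>
    have h : Continuous fun z : ℂ => stepMatrix a ((n : ℤ) + 1) z := by
      refine continuous_matrix fun i j => ?_
      fin_cases i <;> fin_cases j <;> simp [stepMatrix] <;> fun_prop
    exact h.mul ih

lemma continuous_maxTransferNormSq (a : ℤ → ℝ) (N : ℕ) (hN : 1 ≤ N) :
    Continuous (maxTransferNormSq a N hN) := by
  unfold maxTransferNormSq
  exact Continuous.finset_sup'_apply _ fun n _ => ((continuous_transferMatrix a n).norm.pow 2)

lemma maxTransferNormSq_pos {a : ℤ → ℝ} (ha : ∀ n, a n ≠ 0) (N : ℕ) (hN : 1 ≤ N) (z : ℂ) :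
    0 < maxTransferNormSq a N hN z := by
  refine lt_of_lt_of_le ?_ (Finset.le_sup' (fun n => ‖transferMatrix a n z‖ ^ 2)
    (Finset.mem_Icc.2 ⟨le_rfl, hN⟩))
  have : transferMatrix a 1 z ≠ 0 := fun h => by
    have h1 := det_transferMatrix ha 1 z
    rw [h, Matrix.det_zero] at h1
    exact zero_ne_one h1
  positivity

/-! ### The Sturmian sequence -/

lemma sturmianHopping_mem {l₁ l₂ β : ℝ} (hβ : β ∈ Set.Icc (0 : ℝ) 1) (n : ℤ) :
    sturmianHopping l₁ l₂ β n = l₁ ∨ sturmianHopping l₁ l₂ β n = l₂ := by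
  have h1 : ⌊(n : ℝ) * β⌋ ≤ ⌊((n : ℝ) + 1) * β⌋ := Int.floor_le_floor (by nlinarith [hβ.1])
  have h2 : ⌊((n : ℝ) + 1) * β⌋ ≤ ⌊(n : ℝ) * β⌋ + 1 := by
    rw [← Int.floor_add_one]
    exact Int.floor_le_floor (by nlinarith [hβ.2])
  obtain h | h : ⌊((n : ℝ) + 1) * β⌋ - ⌊(n : ℝ) * β⌋ = 0 ∨
      ⌊((n : ℝ) + 1) * β⌋ - ⌊(n : ℝ) * β⌋ = 1 := by lia
  · right
    simp [sturmianHopping, h]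
  · left
    simp [sturmianHopping, h]

lemma floor_neg_of_irrational {x : ℝ} (hx : Irrational x) : ⌊-x⌋ = -⌊x⌋ - 1 := by
  rw [Int.floor_eq_iff]
  have h1 := Int.floor_le x
  have h2 := Int.lt_floor_add_one x
  have h3 : (⌊x⌋ : ℝ) ≠ x := fun h => hx ⟨⌊x⌋, by exact_mod_cast h⟩
  have h4 := lt_of_le_of_ne h1 h3
  push_cast
  constructor <;> linarith

/-- For irrational $x$, $\lfloor-x\rfloor=-\lfloor x\rfloor-1$, and the extra units cancel in the
difference. The index $n=0$ is excluded because $n\beta=0$ is rational there. -/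
lemma sturmianHopping_neg_sub_one {l₁ l₂ β : ℝ} (hβ : Irrational β) {n : ℤ} (hn : 1 ≤ n) :
    sturmianHopping l₁ l₂ β (-n - 1) = sturmianHopping l₁ l₂ β n := by
  have h1 : Irrational ((n : ℝ) * β) := hβ.intCast_mul (by lia)
  have h2 : Irrational (((n : ℝ) + 1) * β) := by
    have := hβ.intCast_mul (m := n + 1) (by lia)
    push_cast at this
    exact this
  unfold sturmianHopping
  rw [show (((-n - 1 : ℤ) : ℝ) + 1) * β = -((n : ℝ) * β) by push_cast; ring,
    show ((-n - 1 : ℤ) : ℝ) * β = -(((n : ℝ) + 1) * β) by push_cast; ring,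
    floor_neg_of_irrational h1, floor_neg_of_irrational h2]
  push_cast
  ring

/-! ### Estimates on the contour -/

lemma norm_intervalIntegral_sq_le {f : ℝ → ℂ} {a b : ℝ} (hab : a < b)
    (hf : ContinuousOn f (Set.uIcc a b)) :
    ‖∫ x in a..b, f x‖ ^ 2 ≤ (b - a) * ∫ x in a..b, ‖f x‖ ^ 2 := by
  have hi1 : IntervalIntegrable (fun x => ‖f x‖) MeasureTheory.volume a b :=
    hf.norm.intervalIntegrable
  have hi2 : IntervalIntegrable (fun x => ‖f x‖ ^ 2) MeasureTheory.volume a b :=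
    (hf.norm.pow 2).intervalIntegrable
  have h1 : ‖∫ x in a..b, f x‖ ≤ ∫ x in a..b, ‖f x‖ :=
    intervalIntegral.norm_integral_le_integral_norm hab.le
  set J := ∫ x in a..b, ‖f x‖ with hJ
  have hL : 0 < b - a := sub_pos.2 hab
  -- Cauchy–Schwarz from the nonnegative variance of $\|f\|$ about its mean $J/(b-a)$.
  have h2 : 0 ≤ ∫ x in a..b, (‖f x‖ ^ 2 - 2 * (J / (b - a)) * ‖f x‖ + (J / (b - a)) ^ 2) := by
    refine intervalIntegral.integral_nonneg hab.le fun x _ => ?_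
    nlinarith [sq_nonneg (‖f x‖ - J / (b - a))]
  rw [intervalIntegral.integral_add (hi2.sub (hi1.const_mul _)) (by simp),
    intervalIntegral.integral_sub hi2 (hi1.const_mul _), intervalIntegral.integral_const_mul,
    intervalIntegral.integral_const, ← hJ, smul_eq_mul] at h2
  have h3 : J ^ 2 ≤ (b - a) * ∫ x in a..b, ‖f x‖ ^ 2 := by
    have := mul_nonneg hL.le h2
    field_simp at this
    linarith
  refine le_trans ?_ h3
  gcongr

lemma norm_exp_neg_I_mul (t : ℝ) (z : ℂ) :
    ‖Complex.exp (-(Complex.I * t) * z)‖ = Real.exp (t * z.im) := by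
  rw [Complex.norm_exp]
  simp

section Contour

variable {a : ℤ → ℝ} {Λ η K : ℝ} (ha : ∀ n, |a n| ≤ Λ)

lemma norm_resolvent_apply_le_of_dist (hη : 0 ≤ η)
    (hΛη : 2 * Λ * (Real.exp η - 1) ≤ 1 / 2) {z : ℂ}
    (hz : ∀ x ∈ spectrum ℂ (hoppingOperator a ⟨Λ, ha⟩), 1 ≤ ‖z - x‖) (n : ℤ) :
    ‖resolvent (hoppingOperator a ⟨Λ, ha⟩) z (delta 1) n‖
      ≤ 2 * Real.exp (-η * |(n : ℝ) - 1|) := by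
  have hR : ‖resolvent (hoppingOperator a ⟨Λ, ha⟩) z‖ ≤ 1 := by
    simpa using norm_resolvent_le (isSelfAdjoint_hoppingOperator a ⟨Λ, ha⟩).isStarNormal
      one_pos hz
  have hz' : z ∉ spectrum ℂ (hoppingOperator a ⟨Λ, ha⟩) := fun h => by
    have := hz z h
    rw [sub_self, norm_zero] at this
    linarith
  have h := norm_resolvent_delta_le ha (b := fun _ => 0) ⟨0, fun _ => by simp⟩ hη hΛη hz' hR 1 n
  rwa [Int.cast_one] at h

lemma norm_contour_integrand_le (hη : 0 ≤ η) (hΛη : 2 * Λ * (Real.exp η - 1) ≤ 1 / 2)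
    {t : ℝ} {z : ℂ} (hz : ∀ x ∈ spectrum ℂ (hoppingOperator a ⟨Λ, ha⟩), 1 ≤ ‖z - x‖)
    (ht : t * z.im ≤ 1) (n : ℤ) :
    ‖Complex.exp (-(Complex.I * t) * z)
        * inner ℂ (delta n) (resolvent (hoppingOperator a ⟨Λ, ha⟩) z (delta 1))‖
      ≤ 2 * Real.exp 1 * Real.exp (-η * |(n : ℝ) - 1|) := by
  rw [norm_mul, norm_exp_neg_I_mul, inner_delta]
  have h1 := norm_resolvent_apply_le_of_dist ha hη hΛη hz n
  have h2 := Real.exp_le_exp.2 ht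
  calc _ ≤ Real.exp 1 * (2 * Real.exp (-η * |(n : ℝ) - 1|)) := by gcongr
    _ = _ := by ring

lemma continuous_inner_resolvent_line {d : ℝ} (hd : 0 < d) (n : ℤ) :
    Continuous fun E : ℝ =>
      inner ℂ (delta n) (resolvent (hoppingOperator a ⟨Λ, ha⟩) (E + d * Complex.I) (delta 1)) := by
  have hsa := isSelfAdjoint_hoppingOperator a ⟨Λ, ha⟩
  have h1 : ContinuousOn (resolvent (hoppingOperator a ⟨Λ, ha⟩)) {z : ℂ | 0 < z.im} :=
    continuousOn_resolvent _ (Set.disjoint_left.2 fun z hz => notMem_spectrum_of_im hsa hz)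
  have h2 : Continuous fun E : ℝ => resolvent (hoppingOperator a ⟨Λ, ha⟩) (E + d * Complex.I) :=
    h1.comp_continuous (by fun_prop) fun E => by simpa using hd
  exact continuous_const.inner (h2.clm_apply continuous_const)

/-- Three sides of the contour fall under Combes–Thomas; the top side is kept intact for the
transfer matrix estimate. The constant $2K+4$ bounds the length of the bottom plus two sides of
height $d+1\le2$. -/
lemma norm_inner_evolution_le (hη : 0 ≤ η)
    (hΛη : 2 * Λ * (Real.exp η - 1) ≤ 1 / 2) (hK : 1 ≤ K)
    (hσ : spectrum ℂ (hoppingOperator a ⟨Λ, ha⟩)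
      ⊆ (fun x : ℝ => (x : ℂ)) '' Set.Icc (-K + 1) (K - 1))
    {t d : ℝ} (ht : 0 < t) (hd : 0 < d) (hd1 : d ≤ 1) (htd : t * d ≤ 1) (n : ℤ) :
    2 * Real.pi * ‖inner ℂ (delta n) (evolution (hoppingOperator a ⟨Λ, ha⟩) t (delta 1))‖
      ≤ ‖∫ E in (-K)..K, Complex.exp (-(Complex.I * t) * (E + d * Complex.I))
          * inner ℂ (delta n)
            (resolvent (hoppingOperator a ⟨Λ, ha⟩) (E + d * Complex.I) (delta 1))‖
        + (2 * K + 4) * (2 * Real.exp 1 * Real.exp (-η * |(n : ℝ) - 1|)) := by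
  set H := hoppingOperator a ⟨Λ, ha⟩ with hH
  have hsa : IsSelfAdjoint H := isSelfAdjoint_hoppingOperator _ _
  set B := 2 * Real.exp 1 * Real.exp (-η * |(n : ℝ) - 1|) with hB
  have hB0 : 0 ≤ B := by positivity
  have hcau := inner_exp_smul_apply_eq_rectIntegral hsa.isStarNormal (a := -K) (b := K) (c := -1)
    (hσ.trans (Set.image_mono fun x hx => ⟨by linarith [hx.1], by linarith [hx.2]⟩))
    (by norm_num) hd (-(Complex.I * t)) (delta n) (delta 1)
  have hdist : ∀ z : ℂ, (z.re = K ∨ z.re = -K ∨ z.im = -1) → ∀ x ∈ spectrum ℂ H, 1 ≤ ‖z - x‖ := by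
    rintro z hz x hx
    obtain ⟨y, hy, rfl⟩ := hσ hx
    have h1 := (le_abs_self _).trans (Complex.abs_re_le_norm (z - y))
    have h2 := (neg_le_abs _).trans (Complex.abs_re_le_norm (z - y))
    have h3 := (neg_le_abs _).trans (Complex.abs_im_le_norm (z - y))
    simp only [Complex.sub_re, Complex.ofReal_re, Complex.sub_im, Complex.ofReal_im] at h1 h2 h3
    change 1 ≤ ‖z - (y : ℂ)‖
    rcases hz with h | h | h <;> linarith [hy.1, hy.2]
  have hbot : ‖∫ x : ℝ in (-K)..K, Complex.exp (-(Complex.I * t) * (x + (-1 : ℝ) * Complex.I))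
      * inner ℂ (delta n) (resolvent H (x + (-1 : ℝ) * Complex.I) (delta 1))‖
      ≤ B * |K - -K| :=
    intervalIntegral.norm_integral_le_of_norm_le_const fun x _ =>
      norm_contour_integrand_le ha hη hΛη (hdist _ (Or.inr (Or.inr (by simp))))
        (by simp; linarith) n
  have hside : ∀ e : ℝ, (e = K ∨ e = -K) →
      ‖∫ y : ℝ in (-1 : ℝ)..d, Complex.exp (-(Complex.I * t) * (e + y * Complex.I))
        * inner ℂ (delta n) (resolvent H (e + y * Complex.I) (delta 1))‖ ≤ B * |d - -1| := by
    intro e he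
    refine intervalIntegral.norm_integral_le_of_norm_le_const fun y hy => ?_
    rw [Set.uIoc_of_le (by linarith)] at hy
    refine norm_contour_integrand_le ha hη hΛη (hdist _ ?_) ?_ n
    · rcases he with he | he <;> simp [he]
    · have : t * y ≤ t * d := mul_le_mul_of_nonneg_left hy.2 ht.le
      simpa using this.trans htd
  have h1 := hside K (Or.inl rfl)
  have h2 := hside (-K) (Or.inr rfl)
  rw [abs_of_nonneg (by linarith)] at hbot h1 h2
  have hnorm : 2 * Real.pi * ‖inner ℂ (delta n) (evolution H t (delta 1))‖
      = ‖(2 * Real.pi * Complex.I : ℂ)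
        * inner ℂ (delta n) (NormedSpace.exp ((-(Complex.I * t)) • H) (delta 1))‖ := by
    rw [norm_mul, evolution]
    simp [abs_of_pos Real.pi_pos]
  rw [hnorm, ← hcau, rectIntegral]
  refine (norm_sub_le _ _).trans ?_
  refine (add_le_add_left (norm_add_le _ _) _).trans ?_
  refine (add_le_add_left (add_le_add_left (norm_sub_le _ _) _) _).trans ?_
  rw [norm_smul, norm_smul, Complex.norm_I, one_mul, one_mul]
  have h3 : B * (d - -1) ≤ B * 2 := mul_le_mul_of_nonneg_left (by linarith) hB0
  linarith

end Contour

section Contour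

variable {a : ℤ → ℝ} {Λ η K : ℝ} (ha : ∀ n, |a n| ≤ Λ)

lemma sum_norm_line_integral_sq_le (ha0 : ∀ n, a n ≠ 0)
    (hrefl : ∀ n, 1 ≤ n → a (-n - 1) = a n) (hK : 0 < K) {t d : ℝ} (hd : 0 < d) (hd1 : d ≤ 1)
    (htd : t * d = 1) {N : ℕ} (hN : 1 ≤ N) {F : Finset ℤ} (hF : ∀ n ∈ F, (N : ℤ) < |n|) :
    ∑ n ∈ F, ‖∫ E in (-K)..K, Complex.exp (-(Complex.I * t) * (E + d * Complex.I))
        * inner ℂ (delta n)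
          (resolvent (hoppingOperator a ⟨Λ, ha⟩) (E + d * Complex.I) (delta 1))‖ ^ 2
      ≤ 2 * K * (Real.exp 1 ^ 2 * (4 * (1 + Λ ^ 2) * (Λ + 1) ^ 2 * (d⁻¹) ^ 4
        * ∫ E in (-K)..K, (maxTransferNormSq a N hN (E + d * Complex.I))⁻¹)) := by
  set g : ℤ → ℝ → ℂ := fun n E => inner ℂ (delta n)
    (resolvent (hoppingOperator a ⟨Λ, ha⟩) (E + d * Complex.I) (delta 1)) with hg
  have hgc : ∀ n, Continuous (g n) := continuous_inner_resolvent_line ha hd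
  have hMc : Continuous fun E : ℝ => (maxTransferNormSq a N hN (E + d * Complex.I))⁻¹ :=
    ((continuous_maxTransferNormSq a N hN).comp (by fun_prop)).inv₀
      fun E => (maxTransferNormSq_pos ha0 N hN _).ne'
  have h1 : ∀ n, ‖∫ E in (-K)..K, Complex.exp (-(Complex.I * t) * (E + d * Complex.I)) * g n E‖ ^ 2
      ≤ 2 * K * (Real.exp 1 ^ 2 * ∫ E in (-K)..K, ‖g n E‖ ^ 2) := by
    intro n
    have h := norm_intervalIntegral_sq_le (a := -K) (b := K)
      (f := fun E : ℝ => Complex.exp (-(Complex.I * t) * (E + d * Complex.I)) * g n E)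
      (by linarith) (Continuous.continuousOn (by have := hgc n; fun_prop))
    refine h.trans_eq ?_
    rw [sub_neg_eq_add, ← two_mul, ← intervalIntegral.integral_const_mul (Real.exp 1 ^ 2)]
    congr 1
    refine intervalIntegral.integral_congr fun E _ => ?_
    have : t * ((E : ℂ) + d * Complex.I).im = 1 := by simpa using htd
    simp only [norm_mul, norm_exp_neg_I_mul, this, mul_pow]
  refine (Finset.sum_le_sum fun n _ => h1 n).trans ?_
  have hsum := intervalIntegral.integral_finsetSum (a := -K) (b := K) (μ := MeasureTheory.volume)
    (s := F) (f := fun n E => ‖g n E‖ ^ 2) fun n _ => ((hgc n).norm.pow 2).intervalIntegrable _ _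
  rw [← Finset.mul_sum, ← Finset.mul_sum, ← hsum,
    ← intervalIntegral.integral_const_mul (4 * (1 + Λ ^ 2) * (Λ + 1) ^ 2 * (d⁻¹) ^ 4)]
  gcongr
  refine intervalIntegral.integral_mono_on (by linarith) ?_ ?_ fun E _ => ?_
  · exact (continuous_finsetSum _ fun n _ => (hgc n).norm.pow 2).intervalIntegrable _ _
  · exact (continuous_const.mul hMc).intervalIntegrable _ _
  · have him : ((E : ℂ) + d * Complex.I).im = d := by simp
    have h := maxTransferNormSq_mul_sum_resolvent_abs_le ha ha0 hrefl
      (z := (E : ℂ) + d * Complex.I) (by rwa [him]) (by rwa [him]) (s := 1) (by simp) hN hF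
    rw [him] at h
    simp only [hg, inner_delta]
    rw [← div_eq_mul_inv, le_div_iff₀ (maxTransferNormSq_pos ha0 N hN _), mul_comm]
    exact h

lemma norm_line_integral_le (hη : 0 ≤ η) (hΛη : 2 * Λ * (Real.exp η - 1) ≤ 1 / 2) (hK : 0 ≤ K)
    {t : ℝ} (ht : t ≤ 1) (n : ℤ) :
    ‖∫ E in (-K)..K, Complex.exp (-(Complex.I * t) * (E + (1 : ℝ) * Complex.I))
        * inner ℂ (delta n)
          (resolvent (hoppingOperator a ⟨Λ, ha⟩) (E + (1 : ℝ) * Complex.I) (delta 1))‖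
      ≤ 2 * K * (2 * Real.exp 1 * Real.exp (-η * |(n : ℝ) - 1|)) := by
  have hsa := isSelfAdjoint_hoppingOperator a ⟨Λ, ha⟩
  have h := intervalIntegral.norm_integral_le_of_norm_le_const (a := -K) (b := K)
    (f := fun E : ℝ => Complex.exp (-(Complex.I * t) * (E + (1 : ℝ) * Complex.I))
        * inner ℂ (delta n)
          (resolvent (hoppingOperator a ⟨Λ, ha⟩) (E + (1 : ℝ) * Complex.I) (delta 1)))
    (C := 2 * Real.exp 1 * Real.exp (-η * |(n : ℝ) - 1|)) fun E _ => by
      refine norm_contour_integrand_le ha hη hΛη (fun x hx => ?_) (by simpa using ht) n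
      have := (le_abs_self _).trans (Complex.abs_im_le_norm ((E + (1 : ℝ) * Complex.I) - x))
      rw [Complex.sub_im, hsa.im_eq_zero_of_mem_spectrum hx] at this
      simpa using this
  rw [abs_of_nonneg (by linarith : 0 ≤ K - -K)] at h
  linarith

end Contour

/-! ### Summation over sites and conclusion -/

lemma summable_exp_neg_mul_abs_int {η : ℝ} (hη : 0 < η) :
    Summable fun n : ℤ => Real.exp (-η * |(n : ℝ)|) := by
  have h : Summable fun n : ℕ => Real.exp (-η * n) := by
    simpa only [mul_comm] using Real.summable_exp_nat_mul_iff.2 (neg_lt_zero.2 hη)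
  refine Summable.of_nat_of_neg ?_ ?_ <;> simpa using h

/-- Of the two factors in the square, one supplies $e^{-\eta N}$ and the other summability;
recentring each from 1 to 0 costs $e^\eta$. -/
lemma sum_exp_sq_le {η : ℝ} (hη : 0 < η) {N : ℕ} {F : Finset ℤ}
    (hF : ∀ n ∈ F, (N : ℤ) < |n|) :
    ∑ n ∈ F, Real.exp (-η * |(n : ℝ) - 1|) ^ 2
      ≤ Real.exp η ^ 2 * (∑' n : ℤ, Real.exp (-η * |(n : ℝ)|)) * Real.exp (-η * N) := by
  have h : ∀ n ∈ F, Real.exp (-η * |(n : ℝ) - 1|) ^ 2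
      ≤ Real.exp η ^ 2 * Real.exp (-η * N) * Real.exp (-η * |(n : ℝ)|) := by
    intro n hn
    have h1 : (N : ℝ) ≤ |(n : ℝ)| := by exact_mod_cast (hF n hn).le
    have h2 : |(n : ℝ)| ≤ |(n : ℝ) - 1| + 1 := by
      simpa using abs_add_le ((n : ℝ) - 1) 1
    rw [← Real.exp_nat_mul, ← Real.exp_nat_mul, ← Real.exp_add, ← Real.exp_add, Real.exp_le_exp]
    push_cast
    nlinarith
  refine (Finset.sum_le_sum h).trans ?_
  rw [← Finset.mul_sum]
  have := (summable_exp_neg_mul_abs_int hη).sum_le_tsum F fun n _ => (Real.exp_pos _).le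
  calc _ ≤ Real.exp η ^ 2 * Real.exp (-η * N) * ∑' n : ℤ, Real.exp (-η * |(n : ℝ)|) := by gcongr
    _ = _ := by ring

lemma norm_sq_le_of_two_pi_mul_le {A x y : ℝ} (hA : 0 ≤ A) (h : 2 * Real.pi * A ≤ x + y) :
    A ^ 2 ≤ x ^ 2 + y ^ 2 := by
  have h2 : 2 * A ≤ x + y := by nlinarith [Real.pi_gt_three]
  nlinarith [sq_nonneg (x - y)]

section Main

variable {a : ℤ → ℝ} {Λ η K : ℝ} (ha : ∀ n, |a n| ≤ Λ)

lemma outsideProb_hoppingOperator_le (ha0 : ∀ n, a n ≠ 0)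
    (hrefl : ∀ n, 1 ≤ n → a (-n - 1) = a n) (hη : 0 < η)
    (hΛη : 2 * Λ * (Real.exp η - 1) ≤ 1 / 2) (hK : 1 ≤ K)
    (hσ : spectrum ℂ (hoppingOperator a ⟨Λ, ha⟩)
      ⊆ (fun x : ℝ => (x : ℂ)) '' Set.Icc (-K + 1) (K - 1))
    {N : ℕ} (hN : 1 ≤ N) {t : ℝ} (ht : 0 < t) :
    outsideProb (hoppingOperator a ⟨Λ, ha⟩) N t
      ≤ ((4 * K + 4) * (2 * Real.exp 1)) ^ 2
          * (Real.exp η ^ 2 * (∑' n : ℤ, Real.exp (-η * |(n : ℝ)|)) * Real.exp (-η * N))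
        + 2 * K * (Real.exp 1 ^ 2 * (4 * (1 + Λ ^ 2) * (Λ + 1) ^ 2 * t ^ 4
          * ∫ E in (-K)..K, (maxTransferNormSq a N hN (E + Complex.I / t))⁻¹)) := by
  set H := hoppingOperator a ⟨Λ, ha⟩ with hH
  have hI : 0 ≤ ∫ E in (-K)..K, (maxTransferNormSq a N hN (E + Complex.I / t))⁻¹ :=
    intervalIntegral.integral_nonneg (by linarith)
      fun E _ => (inv_pos.2 (maxTransferNormSq_pos ha0 N hN _)).le
  have hS : 0 ≤ ∑' n : ℤ, Real.exp (-η * |(n : ℝ)|) := tsum_nonneg fun _ => (Real.exp_pos _).le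
  -- Uniform bounds on finite partial sums of nonnegative terms suffice, so every earlier estimate
  -- is over a finite set.
  refine Real.tsum_le_of_sum_le (fun n => sq_nonneg _) fun G => ?_
  obtain ⟨F, hF, hGF⟩ : ∃ F : Finset ℤ, (∀ n ∈ F, (N : ℤ) < |n|) ∧
      ∑ n ∈ G, siteProb H n t = ∑ n ∈ F, siteProb H n t := by
    refine ⟨G.map (Function.Embedding.subtype _), fun n hn => ?_, by simp⟩
    obtain ⟨m, -, rfl⟩ := Finset.mem_map.1 hn
    exact m.2
  rw [hGF]
  have hexp := sum_exp_sq_le hη hF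
  have hfactor : ∑ n ∈ F, ((4 * K + 4) * (2 * Real.exp 1 * Real.exp (-η * |(n : ℝ) - 1|))) ^ 2
      ≤ ((4 * K + 4) * (2 * Real.exp 1)) ^ 2
          * (Real.exp η ^ 2 * (∑' n : ℤ, Real.exp (-η * |(n : ℝ)|)) * Real.exp (-η * N)) := by
    simp only [← mul_assoc, mul_pow _ (Real.exp (-η * _)), ← Finset.mul_sum] at hexp ⊢
    calc _ ≤ _ := mul_le_mul_of_nonneg_left hexp (sq_nonneg _)
      _ = _ := by ring
  -- For $t\le1$ the contour has height 1 and every side is far from the spectrum. For $t\ge1$ the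
  -- height is $1/t\le1$, as the tail bound requires. The constant $4K+4$ is the $2K+4$ of the three
  -- sides plus the length $2K$ of the top, and serves both cases.
  rcases le_total t 1 with ht1 | ht1
  · refine le_trans (Finset.sum_le_sum fun n _ => ?_)
      (hfactor.trans (le_add_of_nonneg_right (by positivity)))
    have h1 := norm_inner_evolution_le ha hη.le hΛη hK hσ ht one_pos le_rfl (by linarith) n
    have h2 := norm_line_integral_le ha hη.le hΛη (by linarith : 0 ≤ K) ht1 n
    have h3 := norm_sq_le_of_two_pi_mul_le (x := 0)
      (y := (4 * K + 4) * (2 * Real.exp 1 * Real.exp (-η * |(n : ℝ) - 1|)))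
      (norm_nonneg (inner ℂ (delta n) (evolution H t (delta 1)))) (by linarith)
    simpa [siteProb] using h3
  · have htd : t * t⁻¹ = 1 := mul_inv_cancel₀ ht.ne'
    have hd1 : t⁻¹ ≤ 1 := inv_le_one_of_one_le₀ ht1
    have hline := sum_norm_line_integral_sq_le ha ha0 hrefl (by linarith : 0 < K)
      (inv_pos.2 ht) hd1 htd hN hF
    have hcast : ∀ E : ℝ, (E : ℂ) + (t⁻¹ : ℝ) * Complex.I = E + Complex.I / t := fun E => by
      push_cast
      ring
    simp only [inv_inv, hcast] at hline
    refine le_trans (Finset.sum_le_sum fun n _ => ?_) ((Finset.sum_add_distrib).trans_le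
      ((add_le_add hline hfactor).trans_eq (add_comm _ _)))
    have h1 := norm_inner_evolution_le ha hη.le hΛη hK hσ ht (inv_pos.2 ht) hd1 htd.le n
    simp only [hcast] at h1
    refine norm_sq_le_of_two_pi_mul_le (norm_nonneg _) (h1.trans ?_)
    gcongr
    linarith

end Main

end

theorem theorem3 (l₁ l₂ K : ℝ) (hl₁ : 0 < l₁) (hl₂ : 0 < l₂) (hK : 4 ≤ K) :
    ∃ C d : ℝ, 0 < C ∧ 0 < d ∧
      ∀ β : ℝ, Irrational β → β ∈ Set.Icc (0 : ℝ) 1 →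
        spectrum ℂ (sturmianOperator l₁ l₂ β)
            ⊆ (fun x : ℝ => (x : ℂ)) '' Set.Icc (-K + 1) (K - 1) →
          ∀ (N : ℕ) (hN : 1 ≤ N) (t : ℝ), 0 < t →
            outsideProb (sturmianOperator l₁ l₂ β) N t
              ≤ C * (Real.exp (-d * N)
                  + t ^ 4 * ∫ E in (-K)..K,
                      (maxTransferNormSq (sturmianHopping l₁ l₂ β) N hN
                        ((E : ℂ) + Complex.I / (t : ℂ)))⁻¹) := by
  set Λ := max l₁ l₂ with hΛ
  have hΛ0 : 0 < Λ := lt_max_of_lt_left hl₁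
  -- This choice gives equality in the smallness condition of Combes–Thomas, and depends on
  -- $\lambda_1,\lambda_2$ only.
  set η := Real.log (1 + 1 / (4 * Λ)) with hη
  have hη0 : 0 < η := Real.log_pos (by simp [hΛ0])
  have hΛη : 2 * Λ * (Real.exp η - 1) ≤ 1 / 2 := by
    rw [hη, Real.exp_log (by positivity)]
    field_simp
    norm_num
  set S := ∑' n : ℤ, Real.exp (-η * |(n : ℝ)|) with hS
  have hS0 : 0 ≤ S := tsum_nonneg fun _ => (Real.exp_pos _).le
  set C₁ := ((4 * K + 4) * (2 * Real.exp 1)) ^ 2 * (Real.exp η ^ 2 * S) with hC₁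
  set C₂ := 2 * K * (Real.exp 1 ^ 2 * (4 * (1 + Λ ^ 2) * (Λ + 1) ^ 2)) with hC₂
  have hC₁0 : 0 ≤ C₁ := by positivity
  have hC₂0 : 0 < C₂ := by positivity
  refine ⟨C₁ + C₂, η, by positivity, hη0, fun β hirr hβ hσ N hN t ht => ?_⟩
  have ha : ∀ n, |sturmianHopping l₁ l₂ β n| ≤ Λ := fun n => by
    rcases sturmianHopping_mem (l₁ := l₁) (l₂ := l₂) hβ n with h | h <;> rw [h, abs_of_pos ‹_›]
    · exact le_max_left _ _
    · exact le_max_right _ _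
  have ha0 : ∀ n, sturmianHopping l₁ l₂ β n ≠ 0 := fun n => by
    rcases sturmianHopping_mem (l₁ := l₁) (l₂ := l₂) hβ n with h | h <;> rw [h]
    · exact hl₁.ne'
    · exact hl₂.ne'
  have hI : 0 ≤ ∫ E in (-K)..K, (maxTransferNormSq (sturmianHopping l₁ l₂ β) N hN
      ((E : ℂ) + Complex.I / (t : ℂ)))⁻¹ :=
    intervalIntegral.integral_nonneg (by linarith)
      fun E _ => (inv_pos.2 (maxTransferNormSq_pos ha0 N hN _)).le
  -- The two operators differ only in their proofs of boundedness.
  have hop : sturmianOperator l₁ l₂ β = hoppingOperator (sturmianHopping l₁ l₂ β) ⟨Λ, ha⟩ := rfl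
  rw [hop] at hσ ⊢
  have h := outsideProb_hoppingOperator_le ha ha0
    (fun n hn => sturmianHopping_neg_sub_one hirr hn) hη0 hΛη (by linarith) hσ hN ht
  set J := ∫ E in (-K)..K, (maxTransferNormSq (sturmianHopping l₁ l₂ β) N hN
      ((E : ℂ) + Complex.I / (t : ℂ)))⁻¹ with hJ
  have h1 : 0 ≤ C₂ * Real.exp (-η * N) := by positivity
  have h2 : 0 ≤ C₁ * (t ^ 4 * J) := by positivity
  calc _ ≤ _ := h
    _ = C₁ * Real.exp (-η * N) + C₂ * (t ^ 4 * J) := by rw [hC₁, hC₂]; ring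
    _ ≤ _ := by linarith
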